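/- A finite sequence of positive integers $a_1,\dots,a_s$ is called strongly unimodal of size $n$ if $a_1+\dots+a_s=n$ and $a_1<\dots<a_{k-1}<a_k>a_{k+1}>\dots>a_s$ for some $k\in\{1,\dots,s\}$; its rank is $s-2k+1$, the number of terms after the maximal term minus the number of terms before it. For $m\in\mathbb{Z}$ let $u(m,n)$ denote the number of strongly unimodal sequences of size $n$ and rank $m$. Theorem. For every fixed integer $m\ge 0$ we have, as $n\to\infty$, $$u(m,n)\sim\frac{1}{16\sqrt3\,n}\,e^{\pi\sqrt{2n/3}},$$ $$u(m,n)-u(m+1,n)\sim\frac{\pi(2m+1)}{96\sqrt2\,n^{3/2}}\,e^{\pi\sqrt{2n/3}},$$ $$u(m,n)^2-u(m-1,n)\,u(m+1,n)\sim\frac{\pi}{768\sqrt6\,n^{5/2}}\,e^{2\pi\sqrt{2n/3}}.$$ In particular, for every fixed $m\in\mathbb{Z}$ there is an $N$ (depending on $m$) such that $u(m,n)^2>u(m-1,n)\,u(m+1,n)$ for all $n\ge N$. -/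

import Mathlib

/-- The list `a = (a₀, …, a_{s-1})` satisfies `a₀ < ⋯ < a_{k-1} < a_k > a_{k+1} > ⋯ > a_{s-1}`:
it is strongly unimodal with its (unique) maximal term at the position `k`, counted from `0`. -/
def IsStronglyUnimodalAt (a : List ℕ) (k : ℕ) : Prop :=
  k < a.length ∧ (a.take (k + 1)).Pairwise (· < ·) ∧ (a.drop k).Pairwise (· > ·)

/-- The peak position is unique, so the rank below is well defined. -/
theorem IsStronglyUnimodalAt.unique {a : List ℕ} {k l : ℕ} (hk : IsStronglyUnimodalAt a k)
    (hl : IsStronglyUnimodalAt a l) : k = l := by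
  have key : ∀ {k l : ℕ}, IsStronglyUnimodalAt a k → IsStronglyUnimodalAt a l → ¬ k < l := by
    rintro k l ⟨-, -, hk⟩ ⟨hl, hl', -⟩ h
    rw [List.pairwise_iff_getElem] at hk hl'
    have h1 := hk 0 1 (by simp; omega) (by simp; omega) (by omega)
    have h2 := hl' k (k + 1) (by simp; omega) (by simp; omega) (by omega)
    simp at h1 h2
    omega
  have h1 := key hk hl
  have h2 := key hl hk
  omega

/-- The sequence `a` is strongly unimodal of rank `m`: the number of terms after its maximal term
minus the number of terms before it is `m`. -/
def IsStronglyUnimodalOfRank (a : List ℕ) (m : ℤ) : Prop :=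
  ∃ k, IsStronglyUnimodalAt a k ∧ ((a.length : ℤ) - 1 - k) - k = m

/-- `u(m, n)`: the number of strongly unimodal sequences of positive integers of sum `n` and rank
`m`. (A `Composition n` is a finite sequence of positive integers, its `blocks`, of sum `n`; there
are finitely many.) -/
noncomputable def unimodalCount (m : ℤ) (n : ℕ) : ℕ :=
  Nat.card {c : Composition n // IsStronglyUnimodalOfRank c.blocks m}

section

open Complex Filter Topology MeasureTheory

/-- The Euler product `∏ (1 - q ^ n)`, `n ≥ 1`. -/
noncomputable def eulerProd (q : ℂ) : ℂ := ∏' n : ℕ, (1 - q ^ (n + 1))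

lemma norm_exp_neg_lt_one {z : ℂ} (hz : 0 < z.re) : ‖exp (-z)‖ < 1 := by
  simp [Complex.norm_exp, hz]

lemma one_sub_pow_succ_ne_zero {q : ℂ} (hq : ‖q‖ < 1) (n : ℕ) : 1 - q ^ (n + 1) ≠ 0 := by
  intro h
  have h1 : ‖q ^ (n + 1)‖ = 1 := by rw [← sub_eq_zero.mp h, norm_one]
  rw [norm_pow] at h1
  exact (pow_lt_one₀ (norm_nonneg q) hq n.succ_ne_zero).ne h1

lemma eulerProd_ne_zero {q : ℂ} (hq : ‖q‖ < 1) : eulerProd q ≠ 0 := by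
  refine tprod_one_add_ne_zero_of_summable (f := fun n ↦ -q ^ (n + 1)) (fun n ↦ ?_) ?_
  · simpa [← sub_eq_add_neg] using one_sub_pow_succ_ne_zero hq n
  · simpa using (summable_nat_add_iff 1).mpr (summable_geometric_of_lt_one (norm_nonneg _) hq)

lemma hasProd_eulerProd {q : ℂ} (hq : ‖q‖ < 1) :
    HasProd (fun n : ℕ ↦ 1 - q ^ (n + 1)) (eulerProd q) :=
  (ModularForm.multipliable_one_sub_pow hq).hasProd

lemma tendsto_eulerProd_zero : Tendsto eulerProd (𝓝 0) (𝓝 1) := by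
  have h : ContinuousAt eulerProd 0 :=
    (ModularForm.differentiableOn_tprod_one_sub_pow.differentiableAt
      (Metric.ball_mem_nhds 0 one_pos)).continuousAt
  simpa [ContinuousAt, eulerProd] using h

lemma sqrt_I_mul {w : ℂ} (hw : 0 < w.re) : sqrt (I * w) = sqrt I * sqrt w := by
  have hw0 : w ≠ 0 := by rintro rfl; simp at hw
  have harg := abs_arg_lt_pi_div_two_iff.mpr (Or.inl hw)
  rw [abs_lt] at harg
  rw [sqrt_eq_exp (mul_ne_zero I_ne_zero hw0), sqrt_eq_exp I_ne_zero, sqrt_eq_exp hw0,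
    log_mul I_ne_zero hw0 (by rw [arg_I]; constructor <;> linarith [Real.pi_pos]), ← exp_add]
  ring_nf

lemma eta_eq_exp_mul_eulerProd (w : ℂ) :
    ModularForm.eta (I * w / (2 * Real.pi)) = exp (-w / 24) * eulerProd (exp (-w)) := by
  have hpi : (Real.pi : ℂ) ≠ 0 := by exact_mod_cast Real.pi_ne_zero
  have h : 2 * Real.pi * I * (I * w / (2 * Real.pi)) = -w := by
    field_simp
    rw [I_sq]; ring
  simp only [ModularForm.eta, eulerProd, ModularForm.eta_q, Function.Periodic.qParam]
  simp only [h, ofReal_one, div_one, ofReal_ofNat]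

/-- The modular transformation of the Euler product. -/
lemma inv_eulerProd_exp_neg {z : ℂ} (hz : 0 < z.re) :
    (eulerProd (exp (-z)))⁻¹ = sqrt (z / (2 * Real.pi)) * exp (Real.pi ^ 2 / (6 * z)) *
      (exp (-z / 24) / eulerProd (exp (-(4 * Real.pi ^ 2 / z)))) := by
  have hz0 : z ≠ 0 := by rintro rfl; simp at hz
  have hpi : (Real.pi : ℂ) ≠ 0 := by exact_mod_cast Real.pi_ne_zero
  have hpos : 0 < (I * z / (2 * Real.pi)).im := by
    have : I * z / (2 * Real.pi) = ((2 * Real.pi)⁻¹ : ℝ) * (I * z) := by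
      push_cast; field_simp
    rw [this, im_ofReal_mul]
    simp only [mul_im, I_re, I_im, zero_mul, one_mul, zero_add]
    positivity
  have key := ModularForm.eta_comp_eq_csqrt_I_inv hpos
  have hdual : -1 / (I * z / (2 * Real.pi)) = I * (4 * Real.pi ^ 2 / z) / (2 * Real.pi) := by
    field_simp
    rw [I_sq]; ring
  have hsq : sqrt (I * z / (2 * Real.pi)) = sqrt I * sqrt (z / (2 * Real.pi)) := by
    rw [mul_div_assoc, sqrt_I_mul]
    have : z / (2 * Real.pi) = ((2 * Real.pi)⁻¹ : ℝ) * z := by push_cast; field_simp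
    rw [this, re_ofReal_mul]; positivity
  simp only [Function.comp, Pi.smul_apply, Pi.mul_apply, smul_eq_mul, hdual, hsq,
    eta_eq_exp_mul_eulerProd] at key
  have hI : sqrt I ≠ 0 := by simp [sqrt, I_ne_zero]
  have h1 := eulerProd_ne_zero (norm_exp_neg_lt_one hz)
  have hz' : 0 < (4 * Real.pi ^ 2 / z : ℂ).re := by
    have : (4 * Real.pi ^ 2 / z : ℂ) = ((4 * Real.pi ^ 2 : ℝ) : ℂ) * z⁻¹ := by
      push_cast; field_simp
    rw [this, re_ofReal_mul, inv_re]
    have := normSq_pos.mpr hz0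
    positivity
  have h2 := eulerProd_ne_zero (norm_exp_neg_lt_one hz')
  have hexp : exp (-(4 * Real.pi ^ 2 / z) / 24) = (exp (Real.pi ^ 2 / (6 * z)))⁻¹ := by
    rw [← exp_neg]; congr 1; field_simp; ring
  rw [hexp] at key
  have he := exp_ne_zero (Real.pi ^ 2 / (6 * z))
  generalize eulerProd (exp (-(4 * Real.pi ^ 2 / z))) = a at *
  generalize eulerProd (exp (-z)) = b at *
  generalize exp (Real.pi ^ 2 / (6 * z)) = c at *
  generalize sqrt (z / (2 * Real.pi)) = d at *
  generalize exp (-z / 24) = e at *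
  field_simp at key ⊢
  linear_combination key

/-- The filter of approach to `0` inside the cone `|im z| ≤ re z`. -/
noncomputable def coneFilter : Filter ℂ := 𝓝[{z : ℂ | 0 < z.re ∧ |z.im| ≤ z.re}] 0

lemma coneFilter_mem : ∀ᶠ z in coneFilter, 0 < z.re ∧ |z.im| ≤ z.re :=
  eventually_mem_nhdsWithin

lemma norm_le_two_mul_re {z : ℂ} (hz : |z.im| ≤ z.re) : ‖z‖ ≤ 2 * z.re := by
  have h0 := (abs_nonneg _).trans hz
  have := Complex.norm_le_abs_re_add_abs_im z
  rw [abs_of_nonneg h0] at this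
  linarith

lemma tendsto_cone_re : Tendsto Complex.re coneFilter (𝓝[>] 0) := by
  refine tendsto_nhdsWithin_iff.mpr ⟨?_, coneFilter_mem.mono fun z hz ↦ hz.1⟩
  exact (continuous_re.tendsto' 0 0 (by simp)).mono_left nhdsWithin_le_nhds

lemma tendsto_cone_id : Tendsto (fun z : ℂ ↦ z) coneFilter (𝓝 0) := nhdsWithin_le_nhds

/-- In the cone, the dual Euler product tends to `1`. -/
lemma tendsto_dual_factor :
    Tendsto (fun z : ℂ ↦ exp (-z / 24) / eulerProd (exp (-(4 * Real.pi ^ 2 / z))))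
      coneFilter (𝓝 1) := by
  have h1 : Tendsto (fun z : ℂ ↦ exp (-z / 24)) coneFilter (𝓝 1) := by
    have : Continuous (fun z : ℂ ↦ exp (-z / 24)) := by fun_prop
    exact (this.tendsto' 0 1 (by simp)).mono_left nhdsWithin_le_nhds
  have h2 : Tendsto (fun z : ℂ ↦ exp (-(4 * Real.pi ^ 2 / z))) coneFilter (𝓝 0) := by
    rw [tendsto_zero_iff_norm_tendsto_zero]
    have h3 : Tendsto (fun z : ℂ ↦ Real.exp (-(z.re)⁻¹)) coneFilter (𝓝 0) :=
      Real.tendsto_exp_neg_atTop_nhds_zero.comp (tendsto_inv_nhdsGT_zero.comp tendsto_cone_re)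
    refine squeeze_zero' (Eventually.of_forall fun _ ↦ norm_nonneg _) ?_ h3
    filter_upwards [coneFilter_mem] with z ⟨hz, hz'⟩
    rw [norm_exp, Real.exp_le_exp, neg_re, neg_le_neg_iff]
    have hz0 : z ≠ 0 := by rintro rfl; simp at hz
    have : (4 * Real.pi ^ 2 / z : ℂ) = ((4 * Real.pi ^ 2 : ℝ) : ℂ) * z⁻¹ := by
      push_cast; field_simp
    rw [this, re_ofReal_mul, inv_re]
    have hn : normSq z ≤ 4 * z.re ^ 2 := by
      rw [normSq_eq_norm_sq]
      nlinarith [norm_le_two_mul_re hz', norm_nonneg z]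
    have hp := normSq_pos.mpr hz0
    have hpi := Real.pi_gt_three
    rw [← mul_div_assoc, inv_le_iff_one_le_mul₀ hz, div_mul_eq_mul_div, le_div_iff₀ hp, one_mul]
    nlinarith [mul_pos hz hz, mul_le_mul_of_nonneg_right
      (show (1 : ℝ) ≤ Real.pi ^ 2 by nlinarith) (mul_pos hz hz).le]
  simpa [Function.comp_def, Pi.div_def] using
    h1.div (tendsto_eulerProd_zero.comp h2) one_ne_zero

/-- Termwise estimate behind the bound away from the positive real axis. -/
lemma one_sub_norm_mul_exp_le {w : ℂ} (hw : ‖w‖ < 1) :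
    (1 - ‖w‖) * Real.exp ‖w‖ ≤ ‖1 - w‖ * Real.exp w.re := by
  have hne : 1 - w ≠ 0 := by
    intro h
    rw [← sub_eq_zero.mp h, norm_one] at hw
    exact lt_irrefl _ hw
  have h1 : HasSum (fun n : ℕ ↦ (w ^ n / n).re) (-log (1 - w)).re :=
    Complex.hasSum_re (Complex.hasSum_taylorSeries_neg_log hw)
  have h2 : HasSum (fun n : ℕ ↦ ‖w‖ ^ (n + 1) / (n + 1)) (-Real.log (1 - ‖w‖)) :=
    Real.hasSum_pow_div_log_of_abs_lt_one (by simpa using hw)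
  have h1' := (hasSum_nat_add_iff' 2).mpr h1
  have h2' := (hasSum_nat_add_iff' 1).mpr h2
  have hle := hasSum_le (fun n ↦ ?_) h1' h2'
  · simp [Finset.sum_range_succ, log_re] at hle
    rw [← Real.exp_log (sub_pos.mpr hw), ← Real.exp_add, ← Real.exp_log (norm_pos_iff.mpr hne),
      ← Real.exp_add, Real.exp_le_exp]
    linarith
  · refine (re_le_norm _).trans ?_
    rw [norm_div, norm_pow, Complex.norm_natCast]
    push_cast
    rw [show n + 1 + 1 = n + 2 by ring, show (n : ℝ) + 1 + 1 = n + 2 by ring]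

lemma norm_inv_eulerProd_le {q : ℂ} (hq : ‖q‖ < 1) :
    ‖(eulerProd q)⁻¹‖ ≤ ‖(eulerProd (‖q‖ : ℂ))⁻¹‖ *
      Real.exp ((q / (1 - q)).re - ‖q‖ / (1 - ‖q‖)) := by
  have hq' : ‖(‖q‖ : ℂ)‖ < 1 := by simpa using hq
  have hgeo : HasSum (fun n : ℕ ↦ q ^ (n + 1)) (q / (1 - q)) := by
    simpa [pow_succ, div_eq_mul_inv, mul_comm] using (hasSum_geometric_of_norm_lt_one hq).mul_left q
  have hgeo' : HasSum (fun n : ℕ ↦ ‖q‖ ^ (n + 1)) (‖q‖ / (1 - ‖q‖)) := by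
    simpa [pow_succ, div_eq_mul_inv, mul_comm] using
      (hasSum_geometric_of_lt_one (norm_nonneg _) hq).mul_left ‖q‖
  have hP := (hasProd_eulerProd hq).tendsto_prod_nat.norm
  have hP' := (hasProd_eulerProd hq').tendsto_prod_nat.norm
  have hE := (Real.continuous_exp.tendsto _).comp
    ((Complex.hasSum_re hgeo).tendsto_sum_nat)
  have hE' := (Real.continuous_exp.tendsto _).comp hgeo'.tendsto_sum_nat
  have hle := le_of_tendsto_of_tendsto' (hP'.mul hE') (hP.mul hE) fun N ↦ ?_
  · have p1 := norm_pos_iff.mpr (eulerProd_ne_zero hq)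
    have p2 := norm_pos_iff.mpr (eulerProd_ne_zero hq')
    rw [norm_inv, norm_inv, Real.exp_sub, inv_mul_eq_div, ← one_div, div_le_div_iff₀ p1 p2,
      div_mul_eq_mul_div, le_div_iff₀ (Real.exp_pos _)]
    linarith
  · simp only [Function.comp, Real.exp_sum, norm_prod, ← Finset.prod_mul_distrib]
    refine Finset.prod_le_prod (fun i _ ↦ by positivity) fun i _ ↦ ?_
    have hqi : ‖q ^ (i + 1)‖ < 1 := by
      rw [norm_pow]; exact pow_lt_one₀ (norm_nonneg q) hq i.succ_ne_zero
    have := one_sub_norm_mul_exp_le hqi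
    rw [norm_pow] at this
    have h0 : (1 - (‖q‖ : ℂ) ^ (i + 1)) = ((1 - ‖q‖ ^ (i + 1) : ℝ) : ℂ) := by push_cast; rfl
    rw [norm_pow] at hqi
    rwa [h0, norm_real, Real.norm_of_nonneg (by linarith)]

/-- Cauchy's estimates bound iterated differences of an entire function. -/
lemma norm_fwdDiff_iter_le {s : ℂ} {ρ : ℝ} (hρ : 0 < ρ) (r : ℕ) :
    ∀ (f : ℂ → ℂ) (_ : Differentiable ℂ f) (B : ℝ)
      (_ : ∀ w ∈ Metric.closedBall s (r * (ρ + 1)), ‖f w‖ ≤ B),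
      ‖(fwdDiff (1 : ℂ))^[r] f s‖ ≤ B / ρ ^ r := by
  induction r with
  | zero => intro f _ B h; simpa using h s (by simp)
  | succ r ih =>
    intro f hf B h
    rw [Function.iterate_succ_apply, pow_succ', ← div_div]
    refine ih _ (by unfold fwdDiff; fun_prop) _ fun w hw ↦ ?_
    rw [mem_closedBall_iff_norm] at hw
    have hder : ∀ x ∈ Metric.closedBall s (r * (ρ + 1) + 1), ‖deriv f x‖ ≤ B / ρ := by
      intro x hx
      rw [mem_closedBall_iff_norm] at hx
      refine norm_deriv_le_of_forall_mem_sphere_norm_le hρ hf.diffContOnCl fun y hy ↦ h y ?_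
      rw [mem_sphere_iff_norm] at hy
      rw [mem_closedBall_iff_norm]
      have := norm_add_le (y - x) (x - s)
      rw [sub_add_sub_cancel] at this
      push_cast
      linarith
    have := (convex_closedBall s (r * (ρ + 1) + 1)).norm_image_sub_le_of_norm_deriv_le
      (fun x _ ↦ hf x) hder (x := w) (y := w + 1) (by rw [mem_closedBall_iff_norm]; linarith) (by
        rw [mem_closedBall_iff_norm]
        have := norm_add_le (w - s) 1
        rw [norm_one] at this
        rw [show w + 1 - s = w - s + 1 by ring]
        linarith)
    simpa [fwdDiff] using this

lemma fwdDiff_iter_natCast (f : ℂ → ℂ) (c : ℂ) (r j : ℕ) :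
    (fwdDiff 1)^[r] (fun j : ℕ ↦ f (c + j)) j = (fwdDiff (1 : ℂ))^[r] f (c + j) := by
  simp only [fwdDiff_iter_eq_sum_shift]
  refine Finset.sum_congr rfl fun k _ ↦ ?_
  simp [add_assoc]

lemma fwdDiff_iter_tsum {h : ℕ → ℕ → ℂ} (hs : ∀ j, Summable fun k ↦ h k j) (r : ℕ) :
    ∀ j, (fwdDiff 1)^[r] (fun j ↦ ∑' k, h k j) j = ∑' k, (fwdDiff 1)^[r] (h k) j := by
  intro j
  simp only [fwdDiff_iter_eq_sum_shift]
  rw [Summable.tsum_finsetSum fun i _ ↦ (hs _).const_smul _]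
  exact Finset.sum_congr rfl fun i _ ↦ ((hs _).tsum_const_smul _).symm

/-- A null sequence is controlled by its sums of consecutive terms. -/
lemma norm_le_tsum_of_add_succ {S b : ℕ → ℂ} (h : ∀ k, S k + S (k + 1) = b k)
    (hS : Tendsto S atTop (𝓝 0)) (hb : Summable fun k ↦ ‖b k‖) : ‖S 0‖ ≤ ∑' k, ‖b k‖ := by
  have h1 : ∀ n, ‖S 0‖ ≤ ∑ k ∈ Finset.range n, ‖b k‖ + ‖S n‖ := by
    intro n
    induction n with
    | zero => simp
    | succ n ih =>
      rw [Finset.sum_range_succ]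
      have : ‖S n‖ ≤ ‖b n‖ + ‖S (n + 1)‖ := by
        rw [← h n]
        simpa using norm_sub_le (S n + S (n + 1)) (S (n + 1))
      linarith
  have h2 := hb.hasSum.tendsto_sum_nat.add hS.norm
  rw [norm_zero, add_zero] at h2
  exact ge_of_tendsto' h2 h1

lemma tendsto_fwdDiff_iter {S : ℕ → ℂ} (hS : Tendsto S atTop (𝓝 0)) (r : ℕ) :
    Tendsto ((fwdDiff 1)^[r] S) atTop (𝓝 0) := by
  induction r generalizing S with
  | zero => simpa
  | succ r ih =>
    rw [Function.iterate_succ_apply]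
    refine ih ?_
    have := ((tendsto_add_atTop_iff_nat 1).mpr hS).sub hS
    rw [sub_zero] at this
    exact this

lemma norm_fwdDiff_iter_le_tsum {S b : ℕ → ℂ} (h : ∀ k, S k + S (k + 1) = b k)
    (hS : Tendsto S atTop (𝓝 0)) (r : ℕ) (hb : Summable fun k ↦ ‖(fwdDiff 1)^[r] b k‖) :
    ‖(fwdDiff 1)^[r] S 0‖ ≤ ∑' k, ‖(fwdDiff 1)^[r] b k‖ := by
  refine norm_le_tsum_of_add_succ (fun k ↦ ?_) (tendsto_fwdDiff_iter hS r) hb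
  have hb' : b = S + fun k ↦ S (k + 1) := funext fun k ↦ (h k).symm
  rw [hb', fwdDiff_iter_add, Pi.add_apply]
  congr 1
  exact (fwdDiff_iter_comp_add 1 S 1 r k).symm

/-- The truncated Euler transform of order four. -/
noncomputable def eulerFour (a : ℕ → ℂ) : ℂ := (15 * a 0 - 11 * a 1 + 5 * a 2 - a 3) / 16

/-- The truncated Euler transform of order five. -/
noncomputable def eulerFive (a : ℕ → ℂ) : ℂ :=
  (31 * a 0 - 26 * a 1 + 16 * a 2 - 6 * a 3 + a 4) / 32

lemma norm_sub_eulerFour_le {S b : ℕ → ℂ} (h : ∀ k, S k + S (k + 1) = b k)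
    (hS : Tendsto S atTop (𝓝 0)) (hb : Summable fun k ↦ ‖(fwdDiff 1)^[4] b k‖) :
    ‖S 0 - eulerFour b‖ ≤ ∑' k, ‖(fwdDiff 1)^[4] b k‖ := by
  have h1 := norm_fwdDiff_iter_le_tsum h hS 4 hb
  have h2 : S 0 - eulerFour b = (fwdDiff 1)^[4] S 0 / 16 := by
    simp only [eulerFour, ← h, fwdDiff, Function.iterate_succ, Function.iterate_zero,
      Function.comp, id]
    ring
  rw [h2, norm_div]
  refine (div_le_self (norm_nonneg _) (by norm_num)).trans h1

lemma norm_sub_eulerFive_le {S b : ℕ → ℂ} (h : ∀ k, S k + S (k + 1) = b k)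
    (hS : Tendsto S atTop (𝓝 0)) (hb : Summable fun k ↦ ‖(fwdDiff 1)^[5] b k‖) :
    ‖S 0 - eulerFive b‖ ≤ ∑' k, ‖(fwdDiff 1)^[5] b k‖ := by
  have h1 := norm_fwdDiff_iter_le_tsum h hS 5 hb
  have h2 : S 0 - eulerFive b = -(fwdDiff 1)^[5] S 0 / 32 := by
    simp only [eulerFive, ← h, fwdDiff, Function.iterate_succ, Function.iterate_zero,
      Function.comp, id]
    ring
  rw [h2, norm_div, norm_neg]
  refine (div_le_self (norm_nonneg _) (by norm_num)).trans h1

lemma norm_alternating_sub_eulerFour_le {a : ℕ → ℂ} (ha : Summable fun k ↦ ‖a k‖)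
    (hb : Summable fun k ↦ ‖(fwdDiff 1)^[4] a k‖) :
    ‖∑' k, (-1) ^ k * a k - eulerFour a‖ ≤ ∑' k, ‖(fwdDiff 1)^[4] a k‖ := by
  have hs : ∀ n, Summable fun i ↦ ‖(-1) ^ i * a (i + n)‖ := fun n ↦ by
    simpa using (summable_nat_add_iff n).mpr ha
  have := norm_sub_eulerFour_le (S := fun n ↦ ∑' i, (-1) ^ i * a (i + n)) (b := a) (fun k ↦ ?_) ?_ hb
  · simpa using this
  · rw [(hs k).of_norm.tsum_eq_zero_add]
    simp only [pow_zero, one_mul, zero_add, pow_succ, add_assoc, add_comm 1 k]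
    simp only [mul_neg_one, neg_mul, tsum_neg]
    ring
  · rw [tendsto_zero_iff_norm_tendsto_zero]
    refine squeeze_zero (fun _ ↦ norm_nonneg _) (fun n ↦ norm_tsum_le_tsum_norm (hs n)) ?_
    simpa using tendsto_sum_nat_add fun k ↦ ‖a k‖

/-- The general term of the partial theta functions, `q ^ ((t + s) (3 t + s + 1) / 2)` at
`q = exp (-z)`. -/
noncomputable def thetaTerm (z s t : ℂ) : ℂ := exp (-z * ((t + s) * (3 * t + s + 1) / 2))

lemma norm_thetaTerm_le {z : ℂ} {σ : ℝ} (hσ : 0 < σ) (hσ1 : σ ≤ 1) (hre : z.re = σ ^ 2)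
    (him : |z.im| ≤ z.re) {s t : ℝ} (hs : 0 ≤ s) (ht : 0 ≤ t) {v w : ℂ} (hv : ‖v‖ ≤ σ⁻¹)
    (hw : ‖w‖ ≤ σ⁻¹) :
    ‖thetaTerm z (s + v) (t + w)‖ ≤ Real.exp 71 * Real.exp (-(σ * (s + t))) := by
  rw [thetaTerm, norm_exp, ← Real.exp_add, Real.exp_le_exp]
  set E : ℂ := ((t + s) * (3 * w + v) + (w + v) * (3 * t + s + 1) + (w + v) * (3 * w + v)) / 2
    with hE
  have hsplit : -z * (((t + w : ℂ) + (s + v)) * (3 * (t + w) + (s + v) + 1) / 2) =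
      -(z * (((t + s) * (3 * t + s + 1) / 2 : ℝ) : ℂ)) + -(z * E) := by
    rw [hE]; push_cast; ring
  have h1 : ‖3 * w + v‖ ≤ 4 * σ⁻¹ := by
    refine (norm_add_le _ _).trans ?_
    rw [norm_mul]; simp only [norm_ofNat]; linarith
  have h2 : ‖w + v‖ ≤ 2 * σ⁻¹ := (norm_add_le _ _).trans (by linarith)
  have hiσ : 0 < σ⁻¹ := inv_pos.mpr hσ
  have h3 : ‖E‖ ≤ ((t + s) * (4 * σ⁻¹) + 2 * σ⁻¹ * (3 * t + s + 1) + 2 * σ⁻¹ * (4 * σ⁻¹)) / 2 := by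
    rw [hE, norm_div]
    simp only [norm_ofNat]
    refine div_le_div_of_nonneg_right ((norm_add₃_le).trans ?_) (by norm_num)
    have e1 : ‖(t + s : ℂ)‖ = t + s := by
      rw [← ofReal_add, norm_real, Real.norm_of_nonneg (by positivity)]
    have e2 : ‖(3 * t + s + 1 : ℂ)‖ = 3 * t + s + 1 := by
      have : (3 * t + s + 1 : ℂ) = ((3 * t + s + 1 : ℝ) : ℂ) := by push_cast; rfl
      rw [this, norm_real, Real.norm_of_nonneg (by positivity)]
    rw [norm_mul, norm_mul, norm_mul, e1, e2]
    gcongr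
  have h4 : ‖z * E‖ ≤ 2 * σ ^ 2 *
      (((t + s) * (4 * σ⁻¹) + 2 * σ⁻¹ * (3 * t + s + 1) + 2 * σ⁻¹ * (4 * σ⁻¹)) / 2) := by
    rw [norm_mul]
    have := norm_le_two_mul_re him
    rw [hre] at this
    gcongr
  have h5 : 2 * σ ^ 2 *
      (((t + s) * (4 * σ⁻¹) + 2 * σ⁻¹ * (3 * t + s + 1) + 2 * σ⁻¹ * (4 * σ⁻¹)) / 2) =
      σ * ((t + s) * 4 + 2 * (3 * t + s + 1)) + 8 := by
    field_simp
    ring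
  have h6 := neg_le_of_abs_le ((abs_re_le_norm (z * E)).trans (h4.trans_eq h5))
  have h7 := (le_abs_self _).trans ((abs_re_le_norm (z * E)).trans (h4.trans_eq h5))
  rw [hsplit, add_re, neg_re, neg_re, re_mul_ofReal, hre]
  have hst : σ * t ≥ 0 := by positivity
  have hss : σ * s ≥ 0 := by positivity
  nlinarith [sq_nonneg (σ * (s + t) - 11), mul_nonneg hss hst, mul_nonneg hst hst,
    mul_nonneg hσ.le hst, mul_nonneg hσ.le hss]

lemma hasSum_exp_neg_mul {σ : ℝ} (hσ : 0 < σ) :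
    HasSum (fun k : ℕ ↦ Real.exp (-(σ * k))) (1 - Real.exp (-σ))⁻¹ := by
  have := hasSum_geometric_of_lt_one (Real.exp_pos (-σ)).le (by simpa using hσ)
  convert this using 2 with k
  rw [← Real.exp_nat_mul]; congr 1; ring

lemma inv_one_sub_exp_neg_le {σ : ℝ} (hσ : 0 < σ) (hσ1 : σ ≤ 1) :
    (1 - Real.exp (-σ))⁻¹ ≤ 2 / σ := by
  have h1 : Real.exp (-σ) ≤ 1 - σ / 2 := by
    rw [Real.exp_neg, inv_le_comm₀ (Real.exp_pos _) (by linarith)]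
    refine le_trans ?_ (Real.add_one_le_exp σ)
    rw [inv_le_iff_one_le_mul₀ (by linarith)]
    nlinarith
  rw [inv_le_comm₀ (by linarith) (by positivity), inv_div]
  linarith

lemma radius_bounds {σ : ℝ} (hσ : 0 < σ) (hσ1 : σ ≤ 1 / 10) {r : ℕ} (hr : r ≤ 5) :
    0 < σ⁻¹ / 5 - 1 ∧ r * (σ⁻¹ / 5 - 1 + 1) ≤ σ⁻¹ ∧ ((σ⁻¹ / 5 - 1) ^ r)⁻¹ ≤ (10 * σ) ^ r := by
  have h10 : 10 ≤ σ⁻¹ := by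
    rw [le_inv_comm₀ (by norm_num) hσ]; linarith
  refine ⟨by linarith, ?_, ?_⟩
  · have : (r : ℝ) ≤ 5 := by exact_mod_cast hr
    nlinarith
  · rw [← inv_pow]
    refine pow_le_pow_left₀ (inv_nonneg.mpr (by linarith)) ?_ r
    rw [inv_le_comm₀ (by linarith) (by positivity), mul_inv]
    linarith

lemma norm_fwdDiff_thetaTerm_right_le {z : ℂ} {σ : ℝ} (hσ : 0 < σ) (hσ1 : σ ≤ 1 / 10)
    (hre : z.re = σ ^ 2) (him : |z.im| ≤ z.re) {r : ℕ} (hr : r ≤ 5) (s t : ℕ) :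
    ‖(fwdDiff 1)^[r] (fun k : ℕ ↦ thetaTerm z s k) t‖ ≤
      Real.exp 71 * (10 * σ) ^ r * Real.exp (-(σ * (s + t))) := by
  obtain ⟨hρ, hρR, hρr⟩ := radius_bounds hσ hσ1 hr
  have h := fwdDiff_iter_natCast (thetaTerm z s) 0 r t
  simp only [zero_add] at h
  rw [h]
  refine (norm_fwdDiff_iter_le hρ r _ (by unfold thetaTerm; fun_prop)
    (Real.exp 71 * Real.exp (-(σ * (s + t)))) fun w hw ↦ ?_).trans ?_
  · rw [mem_closedBall_iff_norm] at hw
    have := norm_thetaTerm_le hσ (by linarith) hre him s.cast_nonneg t.cast_nonneg (v := 0)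
      (w := w - t) (by simpa using hσ.le) (hw.trans hρR)
    simpa using this
  · rw [div_eq_mul_inv, mul_assoc, mul_assoc, mul_comm (Real.exp (-_))]
    gcongr

lemma norm_fwdDiff_thetaTerm_left_le {z : ℂ} {σ : ℝ} (hσ : 0 < σ) (hσ1 : σ ≤ 1 / 10)
    (hre : z.re = σ ^ 2) (him : |z.im| ≤ z.re) {r : ℕ} (hr : r ≤ 5) (μ s t : ℕ) :
    ‖(fwdDiff 1)^[r] (fun j : ℕ ↦ thetaTerm z (μ + j) t) s‖ ≤
      Real.exp 71 * (10 * σ) ^ r * Real.exp (-(σ * (s + t))) := by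
  obtain ⟨hρ, hρR, hρr⟩ := radius_bounds hσ hσ1 hr
  rw [fwdDiff_iter_natCast (fun w ↦ thetaTerm z w t) μ r s]
  refine (norm_fwdDiff_iter_le hρ r _ (by unfold thetaTerm; fun_prop)
    (Real.exp 71 * Real.exp (-(σ * (s + t)))) fun w hw ↦ ?_).trans ?_
  · rw [mem_closedBall_iff_norm] at hw
    have := norm_thetaTerm_le hσ (by linarith) hre him (s := μ + s) (by positivity)
      t.cast_nonneg (v := w - (μ + s)) (w := 0) (hw.trans hρR) (by simpa using hσ.le)
    push_cast at this
    rw [add_sub_cancel, add_zero] at this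
    refine this.trans ?_
    gcongr
    have : (0 : ℝ) ≤ μ := μ.cast_nonneg
    linarith
  · rw [div_eq_mul_inv, mul_assoc, mul_assoc, mul_comm (Real.exp (-_))]
    gcongr

/-- The alternating partial theta functions. -/
noncomputable def partialTheta (z : ℂ) (μ : ℕ) : ℂ := ∑' k : ℕ, (-1) ^ k * thetaTerm z μ k

lemma norm_partialTheta_sub_le {z : ℂ} {σ : ℝ} (hσ : 0 < σ) (hσ1 : σ ≤ 1 / 10)
    (hre : z.re = σ ^ 2) (him : |z.im| ≤ z.re) (μ : ℕ) :
    ‖partialTheta z μ - eulerFour fun k ↦ thetaTerm z μ k‖ ≤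
      Real.exp 71 * 10 ^ 4 * 2 * σ ^ 3 := by
  have hgeo := hasSum_exp_neg_mul hσ
  have hb : ∀ r ≤ 5, ∀ k : ℕ, ‖(fwdDiff 1)^[r] (fun k : ℕ ↦ thetaTerm z μ k) k‖ ≤
      Real.exp 71 * (10 * σ) ^ r * Real.exp (-(σ * k)) := fun r hr k ↦ by
    refine (norm_fwdDiff_thetaTerm_right_le hσ hσ1 hre him hr μ k).trans ?_
    gcongr
    have : (0 : ℝ) ≤ μ := μ.cast_nonneg
    linarith
  have hsum : ∀ r ≤ 5, Summable fun k ↦ ‖(fwdDiff 1)^[r] (fun k : ℕ ↦ thetaTerm z μ k) k‖ :=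
    fun r hr ↦ Summable.of_nonneg_of_le (fun _ ↦ norm_nonneg _) (hb r hr) (hgeo.summable.mul_left _)
  refine (norm_alternating_sub_eulerFour_le (hsum 0 (by norm_num)) (hsum 4 (by norm_num))).trans ?_
  refine ((hsum 4 (by norm_num)).tsum_le_tsum (hb 4 (by norm_num))
    (hgeo.summable.mul_left _)).trans ?_
  rw [(hgeo.mul_left _).tsum_eq]
  calc _ ≤ Real.exp 71 * (10 * σ) ^ 4 * (2 / σ) := by
        gcongr; exact inv_one_sub_exp_neg_le hσ (by linarith)
    _ = _ := by field_simp

lemma summable_thetaTerm {z : ℂ} {σ : ℝ} (hσ : 0 < σ) (hσ1 : σ ≤ 1 / 10)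
    (hre : z.re = σ ^ 2) (him : |z.im| ≤ z.re) (μ : ℕ) :
    Summable fun k : ℕ ↦ (-1) ^ k * thetaTerm z μ k := by
  refine Summable.of_norm_bounded (g := fun k : ℕ ↦ Real.exp 71 * Real.exp (-(σ * k)))
    ((hasSum_exp_neg_mul hσ).summable.mul_left _) fun k ↦ ?_
  have := norm_fwdDiff_thetaTerm_right_le hσ hσ1 hre him (r := 0) (by norm_num) μ k
  simp only [Function.iterate_zero, id, pow_zero, mul_one] at this
  rw [norm_mul, norm_pow, norm_neg, norm_one, one_pow, one_mul]
  refine this.trans ?_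
  gcongr
  have : (0 : ℝ) ≤ μ := μ.cast_nonneg
  linarith

lemma norm_sub_eulerFive_partialTheta_le {z : ℂ} {σ : ℝ} (hσ : 0 < σ) (hσ1 : σ ≤ 1 / 10)
    (hre : z.re = σ ^ 2) (him : |z.im| ≤ z.re) (μ : ℕ) {S : ℕ → ℂ}
    (h : ∀ j, S j + S (j + 1) = partialTheta z (μ + j)) (hS : Tendsto S atTop (𝓝 0)) :
    ‖S 0 - eulerFive fun j ↦ partialTheta z (μ + j)‖ ≤ Real.exp 71 * 10 ^ 5 * 4 * σ ^ 3 := by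
  have hgeo := hasSum_exp_neg_mul hσ
  have hgle := inv_one_sub_exp_neg_le hσ (by linarith)
  have hb : ∀ j, ‖(fwdDiff 1)^[5] (fun j ↦ partialTheta z (μ + j)) j‖ ≤
      Real.exp 71 * (10 * σ) ^ 5 * (2 / σ) * Real.exp (-(σ * j)) := by
    intro j
    unfold partialTheta
    rw [fwdDiff_iter_tsum (h := fun k j ↦ (-1) ^ k * thetaTerm z (μ + j : ℕ) k)
      (fun j ↦ summable_thetaTerm hσ hσ1 hre him (μ + j))]
    have hterm : ∀ k : ℕ, ‖(fwdDiff 1)^[5] (fun j ↦ (-1) ^ k * thetaTerm z (μ + j : ℕ) k) j‖ ≤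
        Real.exp 71 * (10 * σ) ^ 5 * Real.exp (-(σ * j)) * Real.exp (-(σ * k)) := by
      intro k
      have e : (fun j : ℕ ↦ (-1) ^ k * thetaTerm z (μ + j : ℕ) k) =
          ((-1 : ℂ) ^ k) • fun j : ℕ ↦ thetaTerm z (μ + j) k := by
        ext j; simp
      rw [e, fwdDiff_iter_const_smul, Pi.smul_apply, smul_eq_mul, norm_mul, norm_pow, norm_neg,
        norm_one, one_pow, one_mul]
      refine (norm_fwdDiff_thetaTerm_left_le hσ hσ1 hre him le_rfl μ j k).trans_eq ?_
      rw [mul_assoc _ (Real.exp _) (Real.exp _), ← Real.exp_add]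
      congr 2; ring
    refine (tsum_of_norm_bounded (hgeo.mul_left _) hterm).trans ?_
    rw [mul_right_comm]
    gcongr
  have hsum : Summable fun j ↦ ‖(fwdDiff 1)^[5] (fun j ↦ partialTheta z (μ + j)) j‖ :=
    Summable.of_nonneg_of_le (fun _ ↦ norm_nonneg _) hb (hgeo.summable.mul_left _)
  refine (norm_sub_eulerFive_le h hS hsum).trans ?_
  refine (hsum.tsum_le_tsum hb (hgeo.summable.mul_left _)).trans ?_
  rw [(hgeo.mul_left _).tsum_eq]
  calc _ ≤ Real.exp 71 * (10 * σ) ^ 5 * (2 / σ) * (2 / σ) := by gcongr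
    _ = _ := by field_simp; ring

/-- The exponent of the partial theta functions. -/
noncomputable def thetaExponent (s t : ℂ) : ℂ := (t + s) * (3 * t + s + 1) / 2

lemma thetaTerm_sub_isLittleO (s t : ℂ) :
    (fun z ↦ thetaTerm z s t - (1 - z * thetaExponent s t)) =o[coneFilter] fun z : ℂ ↦ z := by
  have h : HasDerivAt (fun z ↦ thetaTerm z s t) (-thetaExponent s t) 0 := by
    unfold thetaTerm thetaExponent
    have := (((hasDerivAt_id (0 : ℂ)).neg).mul_const ((t + s) * (3 * t + s + 1) / 2)).cexp
    simpa using! this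
  have h' := (hasDerivAt_iff_isLittleO.mp h).mono (nhdsWithin_le_nhds : coneFilter ≤ 𝓝 0)
  simp only [sub_zero, smul_eq_mul] at h'
  refine h'.congr_left fun z ↦ ?_
  simp only [thetaTerm, neg_zero, zero_mul, exp_zero]
  ring

lemma isLittleO_of_norm_le_sqrt_re_pow {R : ℂ → ℂ} {C : ℝ}
    (h : ∀ᶠ z in coneFilter, ‖R z‖ ≤ C * √z.re ^ 3) : R =o[coneFilter] fun z : ℂ ↦ z := by
  have h1 : R =O[coneFilter] fun z ↦ √z.re ^ 3 :=
    Asymptotics.IsBigO.of_bound C (h.mono fun z hz ↦ by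
      rwa [Real.norm_of_nonneg (by positivity)])
  refine h1.trans_isLittleO ?_
  have h2 : (fun z : ℂ ↦ z.re) =O[coneFilter] fun z ↦ ‖z‖ :=
    Asymptotics.IsBigO.of_bound 1 (Eventually.of_forall fun z ↦ by
      simpa using abs_re_le_norm z)
  have h3 : (fun z : ℂ ↦ √z.re) =o[coneFilter] fun _ ↦ (1 : ℝ) := by
    rw [Asymptotics.isLittleO_one_iff]
    have := (Real.continuous_sqrt.tendsto' 0 0 Real.sqrt_zero).comp
      (tendsto_cone_re.mono_right nhdsWithin_le_nhds)
    exact this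
  refine Asymptotics.IsLittleO.of_norm_right ((h3.mul_isBigO h2).congr' ?_ ?_)
  · filter_upwards [coneFilter_mem] with z hz
    rw [pow_succ', Real.sq_sqrt hz.1.le]
  · simp

lemma coneFilter_small : ∀ᶠ z in coneFilter, 0 < √z.re ∧ √z.re ≤ 1 / 10 ∧ z.re = √z.re ^ 2 ∧
    |z.im| ≤ z.re := by
  have h := tendsto_cone_re.eventually (Ioo_mem_nhdsGT (show (0 : ℝ) < 1 / 100 by norm_num))
  filter_upwards [h, coneFilter_mem] with z hz hz'
  refine ⟨Real.sqrt_pos.mpr hz'.1, ?_, (Real.sq_sqrt hz'.1.le).symm, hz'.2⟩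
  rw [Real.sqrt_le_left (by norm_num)]
  linarith [hz.2]

lemma partialTheta_sub_isLittleO (μ : ℕ) :
    (fun z ↦ partialTheta z μ - (1 / 2 - z * eulerFour fun k ↦ thetaExponent μ k))
      =o[coneFilter] fun z : ℂ ↦ z := by
  have h1 : (fun z ↦ partialTheta z μ - eulerFour fun k ↦ thetaTerm z μ k) =o[coneFilter]
      fun z : ℂ ↦ z := by
    refine isLittleO_of_norm_le_sqrt_re_pow (C := Real.exp 71 * 10 ^ 4 * 2)
      (coneFilter_small.mono fun z hz ↦ ?_)
    exact norm_partialTheta_sub_le hz.1 hz.2.1 hz.2.2.1 hz.2.2.2 μ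
  have h2 := fun k : ℕ ↦ thetaTerm_sub_isLittleO μ k
  have h3 := h1.add (((((h2 0).const_mul_left (15 / 16)).add ((h2 1).const_mul_left (-11 / 16))).add
    ((h2 2).const_mul_left (5 / 16))).add ((h2 3).const_mul_left (-1 / 16)))
  refine h3.congr_left fun z ↦ ?_
  simp only [eulerFour]
  ring

/-- The linear coefficient in the expansion of the null solution `S` of
`S j + S (j + 1) = partialTheta z (μ + j)`. -/
noncomputable def linearCoeff (μ : ℕ) : ℂ :=
  eulerFive fun j ↦ eulerFour fun k ↦ thetaExponent (μ + j : ℕ) k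

lemma linearCoeff_succ_sub (μ : ℕ) : linearCoeff (μ + 2) - linearCoeff (μ + 1) = (2 * μ + 1) / 8 := by
  simp only [linearCoeff, eulerFive, eulerFour, thetaExponent]
  push_cast
  ring

lemma sub_linear_isLittleO (μ : ℕ) {S : ℂ → ℕ → ℂ}
    (h : ∀ z : ℂ, 0 < z.re → ∀ j, S z j + S z (j + 1) = partialTheta z (μ + j))
    (hS : ∀ z : ℂ, 0 < z.re → Tendsto (S z) atTop (𝓝 0)) :
    (fun z ↦ S z 0 - (1 / 4 - z * linearCoeff μ)) =o[coneFilter] fun z : ℂ ↦ z := by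
  have h1 : (fun z ↦ S z 0 - eulerFive fun j ↦ partialTheta z (μ + j)) =o[coneFilter]
      fun z : ℂ ↦ z := by
    refine isLittleO_of_norm_le_sqrt_re_pow (C := Real.exp 71 * 10 ^ 5 * 4)
      ((coneFilter_small.and coneFilter_mem).mono fun z ⟨hz, hz'⟩ ↦ ?_)
    exact norm_sub_eulerFive_partialTheta_le hz.1 hz.2.1 hz.2.2.1 hz.2.2.2 μ (h z hz'.1) (hS z hz'.1)
  have h2 := fun j : ℕ ↦ partialTheta_sub_isLittleO (μ + j)
  have h3 := h1.add ((((((h2 0).const_mul_left (31 / 32)).add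
    ((h2 1).const_mul_left (-26 / 32))).add ((h2 2).const_mul_left (16 / 32))).add
    ((h2 3).const_mul_left (-6 / 32))).add ((h2 4).const_mul_left (1 / 32)))
  refine h3.congr_left fun z ↦ ?_
  simp only [linearCoeff, eulerFive]
  ring

lemma integral_exp_int_mul_I {l : ℤ} (hl : l ≠ 0) :
    ∫ y in -Real.pi..Real.pi, exp ((l * I) * y) = 0 := by
  rw [integral_exp_mul_complex (mul_ne_zero (Int.cast_ne_zero.mpr hl) I_ne_zero)]
  have : exp (l * I * Real.pi) = exp (l * I * ((-Real.pi : ℝ) : ℂ)) := by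
    rw [Complex.exp_eq_exp_iff_exists_int]
    exact ⟨l, by push_cast; ring⟩
  rw [this, sub_self, zero_div]

/-- Cauchy's formula for the coefficients, on the circle of radius `exp (-x)`. -/
lemma coeff_eq_integral {a : ℕ → ℝ} {f : ℂ → ℂ} {x : ℝ} (hx : 0 < x)
    (h : ∀ q : ℂ, ‖q‖ < 1 → q ≠ 0 → HasSum (fun n ↦ (a n : ℂ) * q ^ n) (f q)) (n : ℕ) :
    ∫ y in -Real.pi..Real.pi, f (exp (-(x + y * I))) * exp (n * (x + y * I)) =
      2 * Real.pi * a n := by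
  have hpt : ∀ y : ℝ, HasSum (fun k ↦ (a k : ℂ) * exp (-(x + y * I)) ^ k * exp (n * (x + y * I)))
      (f (exp (-(x + y * I))) * exp (n * (x + y * I))) := fun y ↦
    (h _ (norm_exp_neg_lt_one (by simpa using hx)) (exp_ne_zero _)).mul_right _
  have hnorm : ∀ (k : ℕ) (y : ℝ), ‖(a k : ℂ) * exp (-(x + y * I)) ^ k * exp (n * (x + y * I))‖ =
      ‖(a k : ℂ) * exp (-(x + (0 : ℝ) * I)) ^ k * exp (n * (x + (0 : ℝ) * I))‖ := by
    intro k y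
    simp [norm_exp]
  have hsum := intervalIntegral.hasSum_integral_of_dominated_convergence (μ := volume)
    (a := -Real.pi) (b := Real.pi)
    (F := fun (k : ℕ) (y : ℝ) ↦ (a k : ℂ) * exp (-(x + y * I)) ^ k * exp (n * (x + y * I)))
    (f := fun y : ℝ ↦ f (exp (-(x + y * I))) * exp (n * (x + y * I)))
    (fun k _ ↦ ‖(a k : ℂ) * exp (-(x + (0 : ℝ) * I)) ^ k * exp (n * (x + (0 : ℝ) * I))‖)
    (fun k ↦ by
      apply Continuous.aestronglyMeasurable
      fun_prop)
    (fun k ↦ Eventually.of_forall fun y _ ↦ (hnorm k y).le)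
    (Eventually.of_forall fun y _ ↦ (hpt 0).summable.norm)
    (by simp) (Eventually.of_forall fun y _ ↦ hpt y)
  refine hsum.unique ?_
  have hterm : ∀ k : ℕ,
      ∫ y in -Real.pi..Real.pi, (a k : ℂ) * exp (-(x + y * I)) ^ k * exp (n * (x + y * I)) =
      if k = n then (2 * Real.pi * a n : ℂ) else 0 := by
    intro k
    have e : ∀ y : ℝ, (a k : ℂ) * exp (-(x + y * I)) ^ k * exp (n * (x + y * I)) =
        a k * exp ((n - k) * x) * exp ((((n : ℤ) - k : ℤ) * I) * y) := by
      intro y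
      rw [← exp_nat_mul, mul_assoc, mul_assoc, ← exp_add, ← exp_add]
      congr 2
      push_cast
      ring
    simp only [e]
    rw [intervalIntegral.integral_const_mul]
    split_ifs with hk
    · subst hk
      simp
      ring
    · rw [integral_exp_int_mul_I (by omega), mul_zero]
  simp only [hterm]
  exact hasSum_ite_eq n _

/-- The radius parameter of the circle of integration. -/
noncomputable def saddle (n : ℕ) : ℝ := Real.pi / √(6 * n)

lemma saddle_pos {n : ℕ} (hn : n ≠ 0) : 0 < saddle n := by
  have : 0 < (n : ℝ) := by positivity
  unfold saddle; positivity

lemma natCast_eq_saddle {n : ℕ} (hn : n ≠ 0) : (n : ℝ) = Real.pi ^ 2 / (6 * saddle n ^ 2) := by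
  have : 0 < (n : ℝ) := by positivity
  rw [saddle, div_pow, Real.sq_sqrt (by positivity)]
  field_simp

lemma tendsto_saddle : Tendsto saddle atTop (𝓝[>] 0) := by
  refine tendsto_nhdsWithin_iff.mpr ⟨?_, (eventually_ne_atTop 0).mono fun n hn ↦ saddle_pos hn⟩
  refine Tendsto.div_atTop tendsto_const_nhds (Real.tendsto_sqrt_atTop.comp ?_)
  exact tendsto_natCast_atTop_atTop.const_mul_atTop (by norm_num)

lemma sqrt_ofReal_mul {r : ℝ} (hr : 0 < r) {w : ℂ} (hw : w ≠ 0) :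
    sqrt (r * w) = √r * sqrt w := by
  rw [sqrt_eq_exp (mul_ne_zero (ofReal_ne_zero.mpr hr.ne') hw), sqrt_eq_exp hw,
    log_ofReal_mul hr hw, add_div, exp_add]
  congr 1
  rw [← ofReal_ofNat, ← ofReal_div, ← ofReal_exp, Real.sqrt_eq_rpow, Real.rpow_def_of_pos hr,
    mul_one_div]

lemma norm_sqrt_le {w : ℂ} (hw : w ≠ 0) (h : ‖w‖ ≤ 4) : ‖sqrt w‖ ≤ 2 := by
  have h2 : sqrt w ^ 2 = w := by
    rw [sqrt_eq_exp hw, ← exp_nat_mul]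
    push_cast
    rw [mul_div_cancel₀ _ (two_ne_zero), exp_log hw]
  rw [← h2, norm_pow] at h
  nlinarith [norm_nonneg (sqrt w)]

/-- The slowly varying factor of the integrand. -/
noncomputable def slowFactor (F : ℂ → ℂ) (β : ℕ) (z : ℂ) : ℂ :=
  exp (-z / 24) / eulerProd (exp (-(4 * Real.pi ^ 2 / z))) * (F (exp (-z)) / z ^ β)

lemma integrand_eq (F : ℂ → ℂ) (β : ℕ) {x A φ θ : ℝ} (hx : 0 < x) {n : ℝ}
    (hn : n = Real.pi ^ 2 / (6 * x ^ 2)) (hA : A = Real.pi ^ 2 / (6 * x)) (hφ : φ ^ 2 = A * θ ^ 2) :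
    F (exp (-(x + (x * θ : ℝ) * I))) / eulerProd (exp (-(x + (x * θ : ℝ) * I))) *
        exp (n * (x + (x * θ : ℝ) * I)) =
      (√(x / (2 * Real.pi)) * x ^ β * Real.exp (2 * A) : ℝ) *
        (sqrt (1 + θ * I) * (1 + θ * I) ^ β * exp (-(φ ^ 2 / (1 + θ * I))) *
          slowFactor F β (x + (x * θ : ℝ) * I)) := by
  set z : ℂ := x + (x * θ : ℝ) * I with hz
  set w : ℂ := 1 + θ * I with hw
  have hzw : z = x * w := by rw [hz, hw]; push_cast; ring
  have hw0 : w ≠ 0 := by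
    intro h
    have := congrArg re h
    simp [hw] at this
  have hx0 : (x : ℂ) ≠ 0 := ofReal_ne_zero.mpr hx.ne'
  have hz0 : z ≠ 0 := hzw ▸ mul_ne_zero hx0 hw0
  have hzre : 0 < z.re := by simp [hz, hx]
  have hpi : (Real.pi : ℂ) ≠ 0 := by exact_mod_cast Real.pi_ne_zero
  rw [div_eq_mul_inv, inv_eulerProd_exp_neg hzre, slowFactor]
  have h1 : sqrt (z / (2 * Real.pi)) = √(x / (2 * Real.pi)) * sqrt w := by
    rw [← sqrt_ofReal_mul (by positivity) hw0, hzw]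
    congr 1; push_cast; ring
  have h2 : exp (Real.pi ^ 2 / (6 * z)) * exp (n * z) =
      Real.exp (2 * A) * exp (-(φ ^ 2 / w)) := by
    have hφ' : (φ : ℂ) ^ 2 = A * θ ^ 2 := by exact_mod_cast hφ
    rw [ofReal_exp, ← exp_add, ← exp_add, hzw, hφ', hn, hA]
    congr 1
    push_cast
    field_simp
    rw [hw]
    linear_combination (θ : ℂ) ^ 2 * I_sq
  have h3 : z ^ β = x ^ β * w ^ β := by rw [hzw, mul_pow]
  have h4 : F (exp (-z)) = z ^ β * (F (exp (-z)) / z ^ β) := by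
    field_simp
  rw [h1]
  push_cast
  calc _ = z ^ β * (F (exp (-z)) / z ^ β) * (√(x / (2 * Real.pi)) * sqrt w *
        (exp (-z / 24) / eulerProd (exp (-(4 * Real.pi ^ 2 / z))))) *
        (exp (Real.pi ^ 2 / (6 * z)) * exp (n * z)) := by rw [← h4]; ring
    _ = _ := by
      rw [h2]
      generalize F (exp (-z)) / z ^ β = T
      rw [h3]
      push_cast
      ring

/-- The integrand in Cauchy's formula on the circle of radius `exp (-saddle n)`. -/
noncomputable def circleIntegrand (F : ℂ → ℂ) (n : ℕ) (y : ℝ) : ℂ :=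
  F (exp (-(saddle n + y * I))) / eulerProd (exp (-(saddle n + y * I))) *
    exp (n * (saddle n + y * I))

/-- The exponent `n * saddle n`. -/
noncomputable def saddleExp (n : ℕ) : ℝ := Real.pi ^ 2 / (6 * saddle n)

lemma tendsto_saddleExp : Tendsto saddleExp atTop atTop := by
  have h := (tendsto_inv_nhdsGT_zero.comp tendsto_saddle).const_mul_atTop
    (show 0 < Real.pi ^ 2 / 6 by positivity)
  refine h.congr fun n ↦ ?_
  simp only [Function.comp, saddleExp, div_eq_mul_inv, mul_inv, mul_assoc]

/-- The size of the integrand at the saddle point. -/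
noncomputable def saddleSize (β n : ℕ) : ℝ :=
  √(saddle n / (2 * Real.pi)) * saddle n ^ β * Real.exp (2 * saddleExp n)

lemma circleIntegrand_eq (F : ℂ → ℂ) (β : ℕ) {n : ℕ} (hn : n ≠ 0) (φ : ℝ) :
    circleIntegrand F n (saddle n * (φ / √(saddleExp n))) =
      saddleSize β n * (sqrt (1 + (φ / √(saddleExp n) : ℝ) * I) *
        (1 + (φ / √(saddleExp n) : ℝ) * I) ^ β *
        exp (-(φ ^ 2 / (1 + (φ / √(saddleExp n) : ℝ) * I))) *
        slowFactor F β (saddle n + (saddle n * (φ / √(saddleExp n)) : ℝ) * I)) := by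
  have hx := saddle_pos hn
  have hA : 0 < saddleExp n := by unfold saddleExp; positivity
  have := integrand_eq F β hx (natCast_eq_saddle hn) (A := saddleExp n) rfl (φ := φ)
    (θ := φ / √(saddleExp n)) (by rw [div_pow, Real.sq_sqrt hA.le]; field_simp)
  rw [circleIntegrand, saddleSize]
  exact_mod_cast this

lemma tendsto_cone_point (φ : ℝ) :
    Tendsto (fun n ↦ (saddle n + (saddle n * (φ / √(saddleExp n)) : ℝ) * I : ℂ))
      atTop coneFilter := by
  have hθ : Tendsto (fun n ↦ φ / √(saddleExp n)) atTop (𝓝 0) :=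
    tendsto_const_nhds.div_atTop (Real.tendsto_sqrt_atTop.comp tendsto_saddleExp)
  have hs : Tendsto saddle atTop (𝓝 0) := tendsto_saddle.mono_right nhdsWithin_le_nhds
  refine tendsto_nhdsWithin_iff.mpr ⟨?_, ?_⟩
  · have h1 := (continuous_ofReal.tendsto' 0 0 ofReal_zero).comp hs
    have h2 := (continuous_ofReal.tendsto' 0 0 ofReal_zero).comp
      (by simpa using hs.mul hθ : Tendsto (fun n ↦ saddle n * (φ / √(saddleExp n))) atTop (𝓝 0))
    simpa [Function.comp_def] using h1.add (h2.mul_const I)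
  · have h1 := hθ.eventually (Metric.ball_mem_nhds (0 : ℝ) one_pos)
    filter_upwards [h1, eventually_ne_atTop 0] with n hn hn0
    have hx := saddle_pos hn0
    rw [dist_zero_right, Real.norm_eq_abs] at hn
    refine ⟨by simpa using hx, ?_⟩
    simp only [add_im, ofReal_im, mul_im, I_re, I_im, add_re, ofReal_re, mul_re]
    simp only [mul_zero, mul_one, zero_add, sub_zero, add_zero]
    rw [abs_mul, abs_of_pos hx]
    nlinarith

lemma exists_norm_le_of_tendsto_cone {W : ℂ → ℂ} {c : ℂ} (hW : Tendsto W coneFilter (𝓝 c)) :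
    ∃ δ > 0, ∀ z : ℂ, 0 < z.re → |z.im| ≤ z.re → z.re < δ → ‖W z‖ ≤ ‖c‖ + 1 := by
  have h := hW.norm.eventually (gt_mem_nhds (lt_add_one ‖c‖))
  rw [coneFilter, eventually_nhdsWithin_iff, Metric.eventually_nhds_iff] at h
  obtain ⟨ε, hε, h⟩ := h
  refine ⟨ε / 2, by positivity, fun z h1 h2 h3 ↦ (h ?_ ⟨h1, h2⟩).le⟩
  rw [dist_zero_right]
  linarith [norm_le_two_mul_re h2]

lemma norm_one_add_mul_I_le {θ : ℝ} (h : |θ| ≤ 1) : ‖(1 + θ * I : ℂ)‖ ≤ 2 := by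
  refine (norm_add_le _ _).trans ?_
  rw [norm_mul, norm_I, norm_real, Real.norm_eq_abs, norm_one]
  linarith

lemma one_add_mul_I_ne_zero (θ : ℝ) : (1 + θ * I : ℂ) ≠ 0 := by
  intro h
  have := congrArg re h
  simp at this

lemma norm_exp_neg_sq_div_le (φ : ℝ) {θ : ℝ} (h : |θ| ≤ 1) :
    ‖exp (-((φ : ℂ) ^ 2 / (1 + θ * I)))‖ ≤ Real.exp (-(1 / 2) * φ ^ 2) := by
  rw [norm_exp, Real.exp_le_exp, neg_re, div_eq_mul_inv, ← ofReal_pow, re_ofReal_mul, inv_re]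
  have h1 : normSq (1 + θ * I) = 1 + θ ^ 2 := by
    simp [normSq_apply]; ring
  have h2 : (1 + θ * I : ℂ).re = 1 := by simp
  rw [h1, h2]
  have h3 : θ ^ 2 ≤ 1 := by rw [← sq_abs]; exact pow_le_one₀ (abs_nonneg _) h
  have h4 : 1 / 2 ≤ 1 / (1 + θ ^ 2) := one_div_le_one_div_of_le (by positivity) (by linarith)
  nlinarith [sq_nonneg φ]

/-- The contribution of the major arc. -/
lemma tendsto_major_arc {F : ℂ → ℂ} {β : ℕ} {c : ℂ}
    (hW : Tendsto (slowFactor F β) coneFilter (𝓝 c))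
    (hF : ∀ n ≠ 0, Continuous (circleIntegrand F n)) :
    Tendsto (fun n ↦ (∫ φ in -√(saddleExp n)..√(saddleExp n),
        circleIntegrand F n (saddle n * (φ / √(saddleExp n)))) / saddleSize β n) atTop
      (𝓝 (c * √Real.pi)) := by
  obtain ⟨δ, hδ, hbd⟩ := exists_norm_le_of_tendsto_cone hW
  set G : ℕ → ℝ → ℂ := fun n ↦ (Set.Ioc (-√(saddleExp n)) (√(saddleExp n))).indicator fun φ ↦
    circleIntegrand F n (saddle n * (φ / √(saddleExp n))) / saddleSize β n with hG
  have hsize : ∀ n ≠ 0, (saddleSize β n : ℂ) ≠ 0 := by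
    intro n hn
    have := saddle_pos hn
    rw [ofReal_ne_zero]
    unfold saddleSize
    positivity
  have hlim : Tendsto (fun n ↦ ∫ φ, G n φ) atTop (𝓝 (∫ φ : ℝ, c * exp (-(φ : ℂ) ^ 2))) := by
    refine tendsto_integral_filter_of_dominated_convergence
      (fun φ ↦ 2 * 2 ^ β * (‖c‖ + 1) * Real.exp (-(1 / 2) * φ ^ 2)) ?_ ?_ ?_ ?_
    · filter_upwards [eventually_ne_atTop 0] with n hn
      refine AEStronglyMeasurable.indicator (Continuous.aestronglyMeasurable ?_) measurableSet_Ioc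
      exact ((hF n hn).comp (by fun_prop)).div_const _
    · filter_upwards [eventually_ne_atTop 0, tendsto_saddle.eventually (Ioo_mem_nhdsGT hδ)]
        with n hn hnδ
      refine Eventually.of_forall fun φ ↦ ?_
      simp only [hG]
      by_cases hφ : φ ∈ Set.Ioc (-√(saddleExp n)) (√(saddleExp n))
      · rw [Set.indicator_of_mem hφ, circleIntegrand_eq F β hn, mul_div_cancel_left₀ _ (hsize n hn)]
        have hx := saddle_pos hn
        have hA : 0 < √(saddleExp n) := Real.sqrt_pos.mpr (by unfold saddleExp; positivity)
        have hθ : |φ / √(saddleExp n)| ≤ 1 := by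
          rw [abs_div, abs_of_pos hA, div_le_one hA, abs_le]
          exact ⟨hφ.1.le, hφ.2⟩
        generalize φ / √(saddleExp n) = θ at hθ
        rw [norm_mul, norm_mul, norm_mul, norm_pow]
        have h1 := norm_one_add_mul_I_le hθ
        have h2 := norm_sqrt_le (one_add_mul_I_ne_zero θ) (by linarith)
        have h3 := norm_exp_neg_sq_div_le φ hθ
        have h4 := hbd (saddle n + (saddle n * θ : ℝ) * I) (by simpa using hx) (by
          simp only [add_im, ofReal_im, mul_im, I_re, I_im, add_re, ofReal_re, mul_re]
          simp only [mul_zero, mul_one, zero_add, sub_zero, add_zero]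
          rw [abs_mul, abs_of_pos hx]
          nlinarith) (by simpa using hnδ.2)
        calc _ ≤ 2 * 2 ^ β * Real.exp (-(1 / 2) * φ ^ 2) * (‖c‖ + 1) := by gcongr
          _ = _ := by ring
      · rw [Set.indicator_of_notMem hφ, norm_zero]
        positivity
    · exact (integrable_exp_neg_mul_sq (by norm_num)).const_mul _
    · refine Eventually.of_forall fun φ ↦ ?_
      have hθ : Tendsto (fun n ↦ ((φ / √(saddleExp n) : ℝ) : ℂ)) atTop (𝓝 0) :=
        (continuous_ofReal.tendsto' 0 0 ofReal_zero).comp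
          (tendsto_const_nhds.div_atTop (Real.tendsto_sqrt_atTop.comp tendsto_saddleExp))
      have hcontAt : ContinuousAt (fun t : ℂ ↦ sqrt (1 + t * I) * (1 + t * I) ^ β *
          exp (-((φ : ℂ) ^ 2 / (1 + t * I)))) 0 := by
        have h1 : ContinuousAt (fun t : ℂ ↦ 1 + t * I) 0 := by fun_prop
        have h2 : ContinuousAt (fun t : ℂ ↦ sqrt (1 + t * I)) 0 := by
          refine ContinuousAt.comp (g := sqrt) ?_ h1
          exact (differentiableAt_sqrt (by simp)).continuousAt
        exact (h2.mul (h1.pow β)).mul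
          ((continuousAt_const.div h1 (by simp)).neg.cexp)
      have h1 := (hcontAt.tendsto.comp hθ).mul (hW.comp (tendsto_cone_point φ))
      have hval : sqrt (1 + 0 * I) * (1 + 0 * I) ^ β * exp (-((φ : ℂ) ^ 2 / (1 + 0 * I))) * c =
          c * exp (-(φ : ℂ) ^ 2) := by
        simp [sqrt_eq_exp one_ne_zero, mul_comm]
      rw [hval] at h1
      refine h1.congr' ?_
      have hev := (Real.tendsto_sqrt_atTop.comp tendsto_saddleExp).eventually
        (eventually_gt_atTop |φ|)
      filter_upwards [hev, eventually_ne_atTop 0] with n hnφ hn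
      simp only [hG]
      rw [Set.indicator_of_mem, circleIntegrand_eq F β hn, mul_div_cancel_left₀ _ (hsize n hn)]
      · rfl
      · exact ⟨(abs_lt.mp hnφ).1, (abs_lt.mp hnφ).2.le⟩
  have hgauss : ∫ φ : ℝ, c * exp (-(φ : ℂ) ^ 2) = c * √Real.pi := by
    rw [integral_const_mul]
    congr 1
    have h1 : ∀ φ : ℝ, exp (-(φ : ℂ) ^ 2) = ((Real.exp (-1 * φ ^ 2) : ℝ) : ℂ) := fun φ ↦ by
      push_cast; ring_nf
    simp only [h1]
    rw [integral_complex_ofReal, integral_gaussian, div_one]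
  rw [hgauss] at hlim
  refine hlim.congr' ?_
  filter_upwards with n
  rw [hG, integral_indicator measurableSet_Ioc, intervalIntegral.integral_of_le
    (by linarith [Real.sqrt_nonneg (saddleExp n)]), integral_div]

lemma re_sub_le_of_abs_ge {x y : ℝ} (hx : 0 < x) (hx1 : x < 1) (hy : x ≤ |y|)
    (hy' : |y| ≤ Real.pi) :
    (exp (-(x + y * I)) / (1 - exp (-(x + y * I)))).re -
      ‖exp (-(x + y * I))‖ / (1 - ‖exp (-(x + y * I))‖) ≤ 1 - 1 / 10 * x⁻¹ := by
  have hnorm : ‖exp (-(x + y * I))‖ = Real.exp (-x) := by simp [norm_exp]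
  have hex : x + 1 ≤ Real.exp x := Real.add_one_le_exp x
  have h1 : x⁻¹ - 1 ≤ ‖exp (-(x + y * I))‖ / (1 - ‖exp (-(x + y * I))‖) := by
    rw [hnorm]
    have e1 : Real.exp (-x) < 1 := by simpa using hx
    have e2 : 1 - x ≤ Real.exp (-x) := by linarith [Real.add_one_le_exp (-x)]
    rw [le_div_iff₀ (by linarith)]
    have e3 : 0 < x⁻¹ - 1 := by rw [sub_pos]; exact (one_lt_inv₀ hx).mpr hx1
    calc (x⁻¹ - 1) * (1 - Real.exp (-x)) ≤ (x⁻¹ - 1) * x := by gcongr; linarith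
      _ = 1 - x := by field_simp
      _ ≤ _ := e2
  have h2 : exp (-(x + y * I)) / (1 - exp (-(x + y * I))) = (exp (x + y * I) - 1)⁻¹ := by
    have e0 := exp_ne_zero (x + y * I)
    have e1 : 1 - exp (-(x + y * I)) ≠ 0 := by
      simpa using one_sub_pow_succ_ne_zero (norm_exp_neg_lt_one (z := x + y * I) (by simpa using hx)) 0
    rw [exp_neg] at e1 ⊢
    have e2 : exp (x + y * I) - 1 ≠ 0 := by
      intro h
      apply e1
      rw [sub_eq_zero.mp h]; simp
    field_simp
  have h3 : (10 / 9 * x) ^ 2 ≤ ‖exp (x + y * I) - 1‖ ^ 2 := by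
    have e1 : ‖exp (x + y * I) - 1‖ ^ 2 =
        (Real.exp x - 1) ^ 2 + 2 * Real.exp x * (1 - Real.cos y) := by
      rw [← normSq_eq_norm_sq, normSq_apply, sub_re, sub_im, exp_re, exp_im]
      simp
      nlinarith [Real.sin_sq_add_cos_sq y]
    rw [e1]
    have e2 := Real.cos_le_one_sub_mul_cos_sq hy'
    have e3 : x ^ 2 ≤ y ^ 2 := by rw [← sq_abs y]; gcongr
    have e4 : (1 / 5 : ℝ) ≤ 2 / Real.pi ^ 2 := by
      rw [div_le_div_iff₀ (by norm_num) (by positivity)]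
      nlinarith [Real.pi_lt_d2, Real.pi_pos]
    have e5 : 1 / 5 * x ^ 2 ≤ 1 - Real.cos y := by nlinarith [sq_nonneg y]
    nlinarith [sq_nonneg x]
  have h4 : 10 / 9 * x ≤ ‖exp (x + y * I) - 1‖ := by
    nlinarith [norm_nonneg (exp (x + y * I) - 1)]
  have h5 : ‖(exp (x + y * I) - 1)⁻¹‖ ≤ 9 / 10 * x⁻¹ := by
    rw [norm_inv, inv_le_comm₀ (by nlinarith) (by positivity)]
    rw [mul_inv, inv_inv]; norm_num; linarith
  have h6 := (re_le_norm _).trans h5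
  rw [h2]
  linarith

lemma norm_inv_eulerProd_real_le : ∃ δ > 0, ∀ x : ℝ, 0 < x → x < δ →
    ‖(eulerProd (Real.exp (-x) : ℝ))⁻¹‖ ≤ 4 * Real.exp (Real.pi ^ 2 / (6 * x)) := by
  obtain ⟨δ, hδ, h⟩ := exists_norm_le_of_tendsto_cone tendsto_dual_factor
  refine ⟨min δ 1, by positivity, fun x hx hxδ ↦ ?_⟩
  have h1 := h x (by simpa using hx) (by simpa using hx.le)
    (by simpa using hxδ.trans_le (min_le_left _ _))
  have h2 := inv_eulerProd_exp_neg (z := x) (by simpa using hx)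
  have h3 : exp (-(x : ℂ)) = (Real.exp (-x) : ℝ) := by push_cast; rfl
  rw [← h3, h2, norm_mul, norm_mul]
  have h4 : ‖exp ((Real.pi : ℂ) ^ 2 / (6 * x))‖ = Real.exp (Real.pi ^ 2 / (6 * x)) := by
    rw [← Complex.norm_of_nonneg (Real.exp_pos _).le]
    push_cast; rfl
  have h5 : ‖sqrt ((x : ℂ) / (2 * Real.pi))‖ ≤ 2 := by
    have e : (x : ℂ) / (2 * Real.pi) = ((x / (2 * Real.pi) : ℝ) : ℂ) := by push_cast; rfl
    have e1 : 0 < x / (2 * Real.pi) := by positivity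
    rw [e]
    refine norm_sqrt_le (ofReal_ne_zero.mpr e1.ne') ?_
    rw [norm_real, Real.norm_of_nonneg e1.le, div_le_iff₀ (by positivity)]
    nlinarith [Real.pi_gt_three, hxδ.trans_le (min_le_right _ _)]
  rw [norm_one] at h1
  rw [h4]
  calc _ ≤ 2 * Real.exp (Real.pi ^ 2 / (6 * x)) * (1 + 1) := by gcongr
    _ = _ := by ring

/-- The bound on the minor arcs. -/
lemma norm_circleIntegrand_minor_le {F : ℂ → ℂ} {C : ℝ} {K : ℕ} (hC : 0 ≤ C)
    (hF : ∀ q : ℂ, ‖q‖ < 1 → q ≠ 0 → ‖F q‖ ≤ C / (1 - ‖q‖) ^ K) :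
    ∀ᶠ n in atTop, ∀ y : ℝ, saddle n ≤ |y| → |y| ≤ Real.pi →
      ‖circleIntegrand F n y‖ ≤ 4 * C * (2 / saddle n) ^ K *
        (Real.exp (1 - 1 / 10 * (saddle n)⁻¹) * Real.exp (2 * saddleExp n)) := by
  obtain ⟨δ, hδ, h⟩ := norm_inv_eulerProd_real_le
  filter_upwards [eventually_ne_atTop 0, tendsto_saddle.eventually (Ioo_mem_nhdsGT hδ),
    tendsto_saddle.eventually (Ioo_mem_nhdsGT one_pos)] with n hn hnδ hn1 y hy hy'
  have hA : (n : ℝ) * saddle n = saddleExp n := by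
    have := saddle_pos hn
    rw [natCast_eq_saddle hn, saddleExp]
    field_simp
  obtain ⟨hx, hx1⟩ := hn1
  unfold circleIntegrand
  generalize hxe : saddle n = x at *
  have hq : ‖exp (-(x + y * I))‖ < 1 := norm_exp_neg_lt_one (by simpa using hx)
  have hnorm : ‖exp (-(x + y * I))‖ = Real.exp (-x) := by simp [norm_exp]
  have h1 := hF _ hq (exp_ne_zero _)
  have h2 := norm_inv_eulerProd_le hq
  have h3 := re_sub_le_of_abs_ge hx hx1 hy hy'
  have h4 := h x hx hnδ.2
  have h5 : ‖exp (n * (x + y * I))‖ = Real.exp (saddleExp n) := by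
    rw [norm_exp, ← hA]; simp
  rw [norm_mul, div_eq_mul_inv, norm_mul, h5]
  have h6 : C / (1 - ‖exp (-(x + y * I))‖) ^ K ≤ C * (2 / x) ^ K := by
    rw [hnorm, div_eq_mul_inv, ← inv_pow]
    have := inv_one_sub_exp_neg_le hx hx1.le
    have e : 0 < 1 - Real.exp (-x) := by simpa using hx
    gcongr
  have h7 : ‖(eulerProd (exp (-(x + y * I))))⁻¹‖ ≤
      4 * Real.exp (saddleExp n) * Real.exp (1 - 1 / 10 * x⁻¹) := by
    refine h2.trans ?_
    rw [saddleExp, hxe]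
    have e := Real.exp_le_exp.mpr h3
    rw [hnorm] at e ⊢
    gcongr
  calc _ ≤ C * (2 / x) ^ K * (4 * Real.exp (saddleExp n) * Real.exp (1 - 1 / 10 * x⁻¹)) *
        Real.exp (saddleExp n) := by
        have := h1.trans h6
        gcongr
    _ = _ := by rw [two_mul, Real.exp_add]; ring

lemma tendsto_minor_ratio (C : ℝ) (K : ℕ) :
    Tendsto (fun n ↦ C * (saddle n)⁻¹ ^ K * Real.exp (1 - 1 / 10 * (saddle n)⁻¹)) atTop (𝓝 0) := by
  have h := (tendsto_rpow_mul_exp_neg_mul_atTop_nhds_zero (K : ℝ) (1 / 10) (by norm_num)).comp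
    (tendsto_inv_nhdsGT_zero.comp tendsto_saddle)
  have h2 := h.const_mul (C * Real.exp 1)
  rw [mul_zero] at h2
  refine h2.congr fun n ↦ ?_
  simp only [Function.comp, Real.rpow_natCast]
  rw [sub_eq_add_neg, Real.exp_add, ← neg_mul]
  ring

lemma continuous_circleIntegrand {a : ℕ → ℝ} {F : ℂ → ℂ}
    (h : ∀ q : ℂ, ‖q‖ < 1 → q ≠ 0 → HasSum (fun n ↦ (a n : ℂ) * q ^ n) (F q / eulerProd q))
    {n : ℕ} (hn : n ≠ 0) : Continuous (circleIntegrand F n) := by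
  have hx := saddle_pos hn
  have hq : ∀ y : ℝ, ‖exp (-(saddle n + y * I))‖ < 1 := fun y ↦
    norm_exp_neg_lt_one (by simpa using hx)
  have h1 : Continuous fun y : ℝ ↦ ∑' k, (a k : ℂ) * exp (-(saddle n + y * I)) ^ k := by
    refine continuous_tsum (u := fun k ↦ ‖(a k : ℂ) * exp (-(saddle n + (0 : ℝ) * I)) ^ k‖)
      (fun k ↦ by fun_prop) (h _ (hq 0) (exp_ne_zero _)).summable.norm fun k y ↦ ?_
    simp [norm_exp]
  have h2 : circleIntegrand F n = fun y : ℝ ↦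
      (∑' k, (a k : ℂ) * exp (-(saddle n + y * I)) ^ k) * exp (n * (saddle n + y * I)) := by
    ext y
    rw [(h _ (hq y) (exp_ne_zero _)).tsum_eq, circleIntegrand]
  rw [h2]
  exact h1.mul (by fun_prop)

lemma saddle_mul_saddleSize (β : ℕ) {n : ℕ} (hn : n ≠ 0) :
    saddle n / √(saddleExp n) * saddleSize β n =
      √(3 / Real.pi ^ 3) * (saddle n ^ 2 * saddle n ^ β * Real.exp (2 * saddleExp n)) := by
  have hx := saddle_pos hn
  have hA : 0 < saddleExp n := by unfold saddleExp; positivity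
  have h1 : √(saddle n / (2 * Real.pi)) / √(saddleExp n) = √(3 / Real.pi ^ 3) * saddle n := by
    rw [← Real.sqrt_div (by positivity), ← Real.sqrt_sq hx.le, ← Real.sqrt_mul (by positivity),
      Real.sqrt_sq hx.le, saddleExp]
    congr 1
    field_simp
    norm_num
  rw [saddleSize]
  calc _ = saddle n * (√(saddle n / (2 * Real.pi)) / √(saddleExp n)) * saddle n ^ β *
        Real.exp (2 * saddleExp n) := by ring
    _ = _ := by rw [h1]; ring

lemma integral_circleIntegrand_eq {F : ℂ → ℂ} {n : ℕ} (hn : n ≠ 0)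
    (hc : Continuous (circleIntegrand F n)) :
    ∫ y in -Real.pi..Real.pi, circleIntegrand F n y =
      (∫ y in -Real.pi..-saddle n, circleIntegrand F n y) +
      (saddle n / √(saddleExp n) : ℝ) * (∫ φ in -√(saddleExp n)..√(saddleExp n),
        circleIntegrand F n (saddle n * (φ / √(saddleExp n)))) +
      ∫ y in saddle n..Real.pi, circleIntegrand F n y := by
  have hx := saddle_pos hn
  have hA : 0 < √(saddleExp n) := Real.sqrt_pos.mpr (by unfold saddleExp; positivity)
  have h1 := intervalIntegral.smul_integral_comp_mul_left (a := -√(saddleExp n))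
    (b := √(saddleExp n)) (circleIntegrand F n) (saddle n / √(saddleExp n))
  rw [mul_neg, div_mul_cancel₀ _ hA.ne', Complex.real_smul] at h1
  have h2 : ∀ φ : ℝ, saddle n / √(saddleExp n) * φ = saddle n * (φ / √(saddleExp n)) :=
    fun φ ↦ by ring
  simp only [h2] at h1
  rw [h1, intervalIntegral.integral_add_adjacent_intervals (hc.intervalIntegrable _ _)
    (hc.intervalIntegrable _ _), intervalIntegral.integral_add_adjacent_intervals
    (hc.intervalIntegrable _ _) (hc.intervalIntegrable _ _)]

lemma tendsto_integral_circleIntegrand {F : ℂ → ℂ} {β K : ℕ} {c : ℂ} {C : ℝ} (hC : 0 ≤ C)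
    (hF : ∀ q : ℂ, ‖q‖ < 1 → q ≠ 0 → ‖F q‖ ≤ C / (1 - ‖q‖) ^ K)
    (hlim : Tendsto (fun z ↦ F (exp (-z)) / z ^ β) coneFilter (𝓝 c))
    (hc : ∀ n ≠ 0, Continuous (circleIntegrand F n)) :
    Tendsto (fun n ↦ (∫ y in -Real.pi..Real.pi, circleIntegrand F n y) /
      (saddle n ^ 2 * saddle n ^ β * Real.exp (2 * saddleExp n) : ℝ)) atTop
      (𝓝 (√(3 / Real.pi ^ 3) * (c * √Real.pi))) := by
  have hW : Tendsto (slowFactor F β) coneFilter (𝓝 c) := by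
    simpa [slowFactor] using! tendsto_dual_factor.mul hlim
  have hmaj := (tendsto_major_arc hW hc).const_mul ((√(3 / Real.pi ^ 3) : ℝ) : ℂ)
  set T : ℕ → ℝ := fun n ↦ saddle n ^ 2 * saddle n ^ β * Real.exp (2 * saddleExp n) with hT
  set B : ℕ → ℝ := fun n ↦ 4 * C * (2 / saddle n) ^ K *
        (Real.exp (1 - 1 / 10 * (saddle n)⁻¹) * Real.exp (2 * saddleExp n)) with hB
  have hratio : Tendsto (fun n ↦ B n * Real.pi / T n) atTop (𝓝 0) := by
    refine (tendsto_minor_ratio (4 * C * 2 ^ K * Real.pi) (K + 2 + β)).congr' ?_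
    filter_upwards [eventually_ne_atTop 0] with n hn
    have hx := saddle_pos hn
    simp only [hB, hT]
    rw [div_pow, inv_pow, pow_add, pow_add]
    field_simp
  have hminor : ∀ (l r : ℕ → ℝ), (∀ᶠ n in atTop, |r n - l n| ≤ Real.pi ∧
      ∀ y ∈ Set.uIoc (l n) (r n), saddle n ≤ |y| ∧ |y| ≤ Real.pi) →
      Tendsto (fun n ↦ (∫ y in l n..r n, circleIntegrand F n y) / (T n : ℂ)) atTop (𝓝 0) := by
    intro l r hlr
    rw [tendsto_zero_iff_norm_tendsto_zero]
    refine squeeze_zero' (Eventually.of_forall fun _ ↦ norm_nonneg _) ?_ hratio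
    filter_upwards [hlr, norm_circleIntegrand_minor_le hC hF, eventually_ne_atTop 0]
      with n hn hb hn0
    have hx := saddle_pos hn0
    have hTn : 0 < T n := by simp only [hT]; positivity
    have hBn : 0 ≤ B n := by simp only [hB]; positivity
    rw [norm_div, norm_real, Real.norm_of_nonneg hTn.le]
    refine div_le_div_of_nonneg_right ?_ hTn.le
    refine (intervalIntegral.norm_integral_le_of_norm_le_const (C := B n) fun y hy ↦
      hb y (hn.2 y hy).1 (hn.2 y hy).2).trans ?_
    exact mul_le_mul_of_nonneg_left hn.1 hBn
  have hsmall := tendsto_saddle.eventually (Ioo_mem_nhdsGT Real.pi_pos)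
  have hm1 := hminor (fun _ ↦ -Real.pi) (fun n ↦ -saddle n) (by
    filter_upwards [hsmall] with n hn
    refine ⟨by rw [abs_of_nonneg] <;> linarith [hn.1, hn.2], fun y hy ↦ ?_⟩
    rw [Set.uIoc_of_le (by linarith [hn.2])] at hy
    rw [abs_of_neg (by linarith [hy.2, hn.1])]
    constructor <;> linarith [hy.1, hy.2])
  have hm2 := hminor (fun n ↦ saddle n) (fun _ ↦ Real.pi) (by
    filter_upwards [hsmall] with n hn
    refine ⟨by rw [abs_of_nonneg] <;> linarith [hn.1, hn.2], fun y hy ↦ ?_⟩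
    rw [Set.uIoc_of_le hn.2.le] at hy
    rw [abs_of_pos (by linarith [hy.1, hn.1])]
    constructor <;> linarith [hy.1, hy.2])
  have htot := (hm1.add hmaj).add hm2
  rw [zero_add, add_zero] at htot
  refine htot.congr' ?_
  filter_upwards [eventually_ne_atTop 0] with n hn
  have hx := saddle_pos hn
  have hTn : (T n : ℂ) ≠ 0 := by
    rw [ofReal_ne_zero]; simp only [hT]; positivity
  have hSn : (saddleSize β n : ℂ) ≠ 0 := by
    rw [ofReal_ne_zero]; unfold saddleSize; positivity
  have hrel : ((saddle n / √(saddleExp n) : ℝ) : ℂ) * saddleSize β n =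
      (√(3 / Real.pi ^ 3) : ℝ) * T n := by
    exact_mod_cast saddle_mul_saddleSize β hn
  rw [integral_circleIntegrand_eq hn (hc n hn)]
  rw [add_div, add_div]
  congr 2
  rw [mul_div_assoc', div_eq_div_iff hSn hTn]
  linear_combination (-(∫ φ in -√(saddleExp n)..√(saddleExp n),
        circleIntegrand F n (saddle n * (φ / √(saddleExp n))))) * hrel

/-- **Coefficient asymptotics by the circle method** for a multiple of the partition generating
function by a function of moderate growth with a power behaviour at `q = 1`. -/
theorem tendsto_coeff_div {a : ℕ → ℝ} {F : ℂ → ℂ} {β K : ℕ} {c C : ℝ} (hC : 0 ≤ C)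
    (h : ∀ q : ℂ, ‖q‖ < 1 → q ≠ 0 → HasSum (fun n ↦ (a n : ℂ) * q ^ n) (F q / eulerProd q))
    (hF : ∀ q : ℂ, ‖q‖ < 1 → q ≠ 0 → ‖F q‖ ≤ C / (1 - ‖q‖) ^ K)
    (hlim : Tendsto (fun z ↦ F (exp (-z)) / z ^ β) coneFilter (𝓝 c)) :
    Tendsto (fun n : ℕ ↦ a n / (1 / (4 * √3 * n) * Real.exp (Real.pi * √(2 * n / 3)) *
      saddle n ^ β)) atTop (𝓝 c) := by
  have h1 := tendsto_integral_circleIntegrand hC hF hlim fun n hn ↦ continuous_circleIntegrand h hn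
  have h2 := (continuous_re.tendsto _).comp h1
  have h3 := h2.const_mul ((2 * Real.pi * (√3 / (2 * Real.pi ^ 2)))⁻¹)
  have hval : (2 * Real.pi * (√3 / (2 * Real.pi ^ 2)))⁻¹ *
      ((√(3 / Real.pi ^ 3) : ℝ) * ((c : ℂ) * (√Real.pi : ℝ)) : ℂ).re = c := by
    have e : ((√(3 / Real.pi ^ 3) : ℝ) * ((c : ℂ) * (√Real.pi : ℝ)) : ℂ).re =
        c * (√(3 / Real.pi ^ 3) * √Real.pi) := by
      rw [← ofReal_mul, ← ofReal_mul, ofReal_re]; ring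
    rw [e, ← Real.sqrt_mul (by positivity),
      show 3 / Real.pi ^ 3 * Real.pi = 3 / Real.pi ^ 2 by field_simp,
      Real.sqrt_div (by norm_num), Real.sqrt_sq Real.pi_pos.le]
    have : √3 ≠ 0 := by positivity
    field_simp
  rw [hval] at h3
  refine h3.congr' ?_
  filter_upwards [eventually_ne_atTop 0] with n hn
  have hx := saddle_pos hn
  have hn' : (0 : ℝ) < n := by positivity
  have hint : ∫ y in -Real.pi..Real.pi, circleIntegrand F n y = 2 * Real.pi * a n :=
    coeff_eq_integral hx h n
  have hexp : Real.pi * √(2 * n / 3) = 2 * saddleExp n := by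
    rw [saddleExp, saddle]
    have e : √(6 * (n : ℝ)) = 3 * √(2 * n / 3) := by
      rw [show (6 * (n : ℝ)) = 3 ^ 2 * (2 * n / 3) by ring, Real.sqrt_mul (by norm_num),
        Real.sqrt_sq (by norm_num)]
    rw [e]
    have : √(2 * (n : ℝ) / 3) ≠ 0 := by positivity
    field_simp
    norm_num
  have hsq : 1 / (4 * √3 * n) = √3 / (2 * Real.pi ^ 2) * saddle n ^ 2 := by
    rw [natCast_eq_saddle hn]
    have e : √3 * √3 = 3 := Real.mul_self_sqrt (by norm_num)
    have e0 : √3 ≠ 0 := by positivity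
    field_simp
    rw [sq, e]; norm_num
  simp only [Function.comp, hint, hexp, hsq]
  have hre : (2 * Real.pi * a n / (saddle n ^ 2 * saddle n ^ β * Real.exp (2 * saddleExp n) : ℝ) : ℂ).re
      = 2 * Real.pi * a n / (saddle n ^ 2 * saddle n ^ β * Real.exp (2 * saddleExp n)) := by
    rw [← ofReal_re (2 * Real.pi * a n / _)]
    push_cast; rfl
  rw [hre]
  have e0 : √3 ≠ 0 := by positivity
  field_simp

/-- A strongly unimodal sequence with peak `N + 1`, encoded by the sets of its terms before and
after the peak. -/
abbrev UnimodalData : Type :=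
  Σ N : ℕ, ↥((Finset.Icc 1 N).powerset ×ˢ (Finset.Icc 1 N).powerset)

namespace UnimodalData

/-- The set of terms before the peak. -/
def left (t : UnimodalData) : Finset ℕ := t.2.1.1

/-- The set of terms after the peak. -/
def right (t : UnimodalData) : Finset ℕ := t.2.1.2

/-- The sum of the terms. -/
def size (t : UnimodalData) : ℕ := t.1 + 1 + ∑ i ∈ t.left, i + ∑ i ∈ t.right, i

/-- The rank. -/
def rank (t : UnimodalData) : ℤ := t.right.card - t.left.card

/-- The sequence itself. -/
def toList (t : UnimodalData) : List ℕ :=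
  t.left.sort (· ≤ ·) ++ (t.1 + 1) :: t.right.sort (· ≥ ·)

lemma mem_left {t : UnimodalData} {i : ℕ} (h : i ∈ t.left) : 1 ≤ i ∧ i ≤ t.1 := by
  have := (Finset.mem_product.mp t.2.2).1
  exact Finset.mem_Icc.mp (Finset.mem_powerset.mp this h)

lemma mem_right {t : UnimodalData} {i : ℕ} (h : i ∈ t.right) : 1 ≤ i ∧ i ≤ t.1 := by
  have := (Finset.mem_product.mp t.2.2).2
  exact Finset.mem_Icc.mp (Finset.mem_powerset.mp this h)

lemma sum_toList (t : UnimodalData) : t.toList.sum = t.size := by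
  have h1 : ∀ (s : Finset ℕ), (s.sort (· ≤ ·)).sum = ∑ i ∈ s, i := fun s ↦ by
    rw [← Multiset.sum_coe, Finset.sort_eq, Finset.sum_val]; rfl
  have h2 : ∀ (s : Finset ℕ), (s.sort (· ≥ ·)).sum = ∑ i ∈ s, i := fun s ↦ by
    rw [← Multiset.sum_coe, Finset.sort_eq, Finset.sum_val]; rfl
  rw [toList, List.sum_append, List.sum_cons, h1, h2, size]
  ring

lemma pos_of_mem_toList {t : UnimodalData} {i : ℕ} (h : i ∈ t.toList) : 0 < i := by
  simp only [toList, List.mem_append, List.mem_cons, Finset.mem_sort] at h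
  rcases h with h | h | h
  · exact (mem_left h).1
  · omega
  · exact (mem_right h).1

lemma pairwise_sort_ge (s : Finset ℕ) : (s.sort (· ≥ ·)).Pairwise (· > ·) := by
  refine ((Finset.pairwise_sort s (· ≥ ·)).and (Finset.sort_nodup s (· ≥ ·))).imp ?_
  intro a b h
  exact lt_of_le_of_ne h.1 (Ne.symm h.2)

lemma isStronglyUnimodalAt_toList (t : UnimodalData) :
    IsStronglyUnimodalAt t.toList t.left.card := by
  have hlen : (t.left.sort (· ≤ ·)).length = t.left.card := Finset.length_sort _
  refine ⟨by simp [toList], ?_, ?_⟩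
  · have : t.toList.take (t.left.card + 1) = t.left.sort (· ≤ ·) ++ [t.1 + 1] := by
      rw [toList, ← hlen, List.take_length_add_append]; simp
    rw [this, List.pairwise_append]
    refine ⟨(Finset.sortedLT_sort _).pairwise, by simp, fun a ha b hb ↦ ?_⟩
    rw [Finset.mem_sort] at ha
    rw [List.mem_singleton] at hb
    have := (mem_left ha).2
    omega
  · rw [toList, List.drop_left' hlen, List.pairwise_cons]
    refine ⟨fun a ha ↦ ?_, pairwise_sort_ge _⟩
    rw [Finset.mem_sort] at ha
    have := (mem_right ha).2
    show a < t.1 + 1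
    omega

lemma isStronglyUnimodalOfRank_toList (t : UnimodalData) :
    IsStronglyUnimodalOfRank t.toList t.rank := by
  refine ⟨_, t.isStronglyUnimodalAt_toList, ?_⟩
  simp only [toList, rank, List.length_append, List.length_cons, Finset.length_sort]
  push_cast
  ring

lemma rank_unique {a : List ℕ} {m l : ℤ} (hm : IsStronglyUnimodalOfRank a m)
    (hl : IsStronglyUnimodalOfRank a l) : m = l := by
  obtain ⟨k, hk, rfl⟩ := hm
  obtain ⟨k', hk', rfl⟩ := hl
  rw [hk.unique hk']

lemma toList_injective : Function.Injective toList := by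
  intro t t' h
  have hk : t.left.card = t'.left.card :=
    t.isStronglyUnimodalAt_toList.unique (h ▸ t'.isStronglyUnimodalAt_toList)
  have hlen : (t.left.sort (· ≤ ·)).length = (t'.left.sort (· ≤ ·)).length := by
    simpa using hk
  obtain ⟨h1, h2⟩ := List.append_inj h hlen
  obtain ⟨h3, h4⟩ := List.cons.inj h2
  have hl : t.left = t'.left := by
    rw [← Finset.sort_toFinset t.left (· ≤ ·), h1, Finset.sort_toFinset]
  have hr : t.right = t'.right := by
    rw [← Finset.sort_toFinset t.right (· ≥ ·), h4, Finset.sort_toFinset]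
  obtain ⟨N, ⟨⟨A, B⟩, hAB⟩⟩ := t
  obtain ⟨N', ⟨⟨A', B'⟩, hAB'⟩⟩ := t'
  simp only [left, right] at hl hr
  obtain rfl : N = N' := by simpa using h3
  subst hl hr
  rfl

lemma exists_toList_eq {a : List ℕ} {k : ℕ} (ha : ∀ i ∈ a, 0 < i)
    (h : IsStronglyUnimodalAt a k) : ∃ t : UnimodalData, t.toList = a := by
  obtain ⟨hk, h1, h2⟩ := h
  have htake : a.take (k + 1) = a.take k ++ [a[k]] := by simp
  have hdrop : a.drop k = a[k] :: a.drop (k + 1) := List.drop_eq_getElem_cons hk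
  rw [htake, List.pairwise_append] at h1
  rw [hdrop, List.pairwise_cons] at h2
  have hp : 0 < a[k] := ha _ (List.getElem_mem hk)
  have hA : (a.take k).toFinset ⊆ Finset.Icc 1 (a[k] - 1) := fun i hi ↦ by
    rw [List.mem_toFinset] at hi
    have := h1.2.2 i hi a[k] (by simp)
    have := ha i (List.mem_of_mem_take hi)
    rw [Finset.mem_Icc]; omega
  have hB : (a.drop (k + 1)).toFinset ⊆ Finset.Icc 1 (a[k] - 1) := fun i hi ↦ by
    rw [List.mem_toFinset] at hi
    have : a[k] > i := h2.1 i hi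
    have := ha i (List.mem_of_mem_drop hi)
    rw [Finset.mem_Icc]; omega
  refine ⟨⟨a[k] - 1, ⟨((a.take k).toFinset, (a.drop (k + 1)).toFinset),
    Finset.mem_product.mpr ⟨Finset.mem_powerset.mpr hA, Finset.mem_powerset.mpr hB⟩⟩⟩, ?_⟩
  have e1 : (a.take k).toFinset.sort (· ≤ ·) = a.take k :=
    (List.toFinset_sort _ (h1.1.imp fun h ↦ h.ne)).mpr (h1.1.imp fun h ↦ h.le)
  have e2 : (a.drop (k + 1)).toFinset.sort (· ≥ ·) = a.drop (k + 1) :=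
    (List.toFinset_sort _ (h2.2.imp fun h ↦ h.ne')).mpr (h2.2.imp fun h ↦ h.le)
  simp only [toList, left, right]
  rw [e1, e2, Nat.sub_add_cancel hp, ← hdrop, List.take_append_drop]

/-- The data of given rank and size correspond to the strongly unimodal compositions. -/
lemma unimodalCount_eq (m : ℤ) (n : ℕ) :
    unimodalCount m n = Nat.card {t : UnimodalData // t.size = n ∧ t.rank = m} := by
  refine (Nat.card_eq_of_bijective (fun t : {t : UnimodalData // t.size = n ∧ t.rank = m} ↦
    (⟨⟨t.1.toList, pos_of_mem_toList, t.1.sum_toList.trans t.2.1⟩,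
      t.2.2.subst (motive := IsStronglyUnimodalOfRank _) t.1.isStronglyUnimodalOfRank_toList⟩ :
      {c : Composition n // IsStronglyUnimodalOfRank c.blocks m})) ⟨?_, ?_⟩).symm
  · intro t t' h
    exact Subtype.ext (toList_injective (congrArg (fun c ↦ c.1.blocks) h))
  · rintro ⟨c, hc⟩
    obtain ⟨k, hk, hr⟩ := id hc
    obtain ⟨t, ht⟩ := exists_toList_eq (fun i hi ↦ c.blocks_pos hi) hk
    refine ⟨⟨t, ?_, ?_⟩, ?_⟩
    · rw [← t.sum_toList, ht, c.blocks_sum]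
    · exact rank_unique t.isStronglyUnimodalOfRank_toList (ht ▸ hc)
    · exact Subtype.ext (Composition.ext ht)

/-- Reversal of the sequence. -/
def swap (t : UnimodalData) : UnimodalData :=
  ⟨t.1, ⟨t.2.1.swap, by
    have := Finset.mem_product.mp t.2.2
    exact Finset.mem_product.mpr ⟨this.2, this.1⟩⟩⟩

lemma size_swap (t : UnimodalData) : t.swap.size = t.size := by
  simp only [size, left, right, swap, Prod.fst_swap, Prod.snd_swap]
  ring

lemma rank_swap (t : UnimodalData) : t.swap.rank = -t.rank := by
  simp only [rank, left, right, swap, Prod.fst_swap, Prod.snd_swap]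
  ring

lemma unimodalCount_neg (m : ℤ) (n : ℕ) : unimodalCount (-m) n = unimodalCount m n := by
  rw [unimodalCount_eq, unimodalCount_eq]
  refine Nat.card_congr
    { toFun := fun t ↦ ⟨t.1.swap, ?_⟩, invFun := fun t ↦ ⟨t.1.swap, ?_⟩,
      left_inv := fun t ↦ rfl, right_inv := fun t ↦ rfl }
  · exact ⟨t.1.size_swap.trans t.2.1, by rw [rank_swap, t.2.2, neg_neg]⟩
  · exact ⟨t.1.size_swap.trans t.2.1, by rw [rank_swap, t.2.2]⟩

instance (n : ℕ) : Finite {t : UnimodalData // t.size = n} := by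
  refine Finite.of_injective (fun t ↦ (⟨t.1.toList, pos_of_mem_toList,
    t.1.sum_toList.trans t.2⟩ : Composition n)) fun t t' h ↦ ?_
  exact Subtype.ext (toList_injective (congrArg Composition.blocks h))

end UnimodalData

/-- The finite `q`-factorial `(1 - q) ⋯ (1 - q ^ n)`. -/
noncomputable def qFac (q : ℂ) (n : ℕ) : ℂ := ∏ i ∈ Finset.range n, (1 - q ^ (i + 1))

lemma qFac_succ (q : ℂ) (n : ℕ) : qFac q (n + 1) = qFac q n * (1 - q ^ (n + 1)) :=
  Finset.prod_range_succ _ _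

lemma qFac_zero (q : ℂ) : qFac q 0 = 1 := rfl

lemma qFac_ne_zero {q : ℂ} (hq : ‖q‖ < 1) (n : ℕ) : qFac q n ≠ 0 :=
  Finset.prod_ne_zero_iff.mpr fun i _ ↦ one_sub_pow_succ_ne_zero hq i

lemma qFac_add (q : ℂ) (n k : ℕ) :
    qFac q (n + k) = qFac q n * ∏ i ∈ Finset.range k, (1 - q ^ (n + i + 1)) :=
  Finset.prod_range_add _ _ _

lemma tendsto_qFac {q : ℂ} (hq : ‖q‖ < 1) : Tendsto (qFac q) atTop (𝓝 (eulerProd q)) :=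
  (hasProd_eulerProd hq).tendsto_prod_nat

lemma exists_norm_inv_qFac_le {q : ℂ} (hq : ‖q‖ < 1) : ∃ M, ∀ n, ‖(qFac q n)⁻¹‖ ≤ M := by
  have h := ((tendsto_qFac hq).inv₀ (eulerProd_ne_zero hq)).norm.bddAbove_range
  obtain ⟨M, hM⟩ := h
  exact ⟨M, fun n ↦ hM ⟨n, rfl⟩⟩

section QBinomial

open Polynomial

/-- The **`q`-binomial theorem**, coefficientwise. -/
lemma coeff_prod_one_add_pow_mul_X {q : ℂ} (hq : ‖q‖ < 1) (n : ℕ) : ∀ k,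
    (∏ i ∈ Finset.range n, (1 + C (q ^ i) * X)).coeff k =
      if k ≤ n then q ^ k.choose 2 * qFac q n / (qFac q k * qFac q (n - k)) else 0 := by
  induction n with
  | zero =>
    intro k
    rcases k with _ | k
    · simp [qFac_zero]
    · simp [coeff_one]
  | succ n ih =>
    intro k
    rw [Finset.prod_range_succ, mul_add, mul_one, coeff_add]
    rcases k with _ | k
    · rw [ih]
      simp [qFac_zero, qFac_ne_zero hq, ← mul_assoc]
    · rw [mul_comm (C _), ← mul_assoc, coeff_mul_C, coeff_mul_X, ih, ih]
      have hk := qFac_ne_zero hq k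
      have hk1 := one_sub_pow_succ_ne_zero hq k
      rcases lt_trichotomy k n with h | h | h
      · obtain ⟨d, rfl⟩ := Nat.exists_eq_add_of_le (show k + 1 ≤ n from h)
        have hd := qFac_ne_zero hq d
        have hd1 := one_sub_pow_succ_ne_zero hq d
        rw [if_pos (by omega), if_pos (by omega), if_pos (by omega),
          show k + 1 + d - (k + 1) = d by omega, show k + 1 + d - k = d + 1 by omega,
          show k + 1 + d + 1 - (k + 1) = d + 1 by omega, qFac_succ q (k + 1 + d), qFac_succ q k,
          qFac_succ q d, Nat.choose_succ_succ' k 1, Nat.choose_one_right, pow_add q k]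
        field_simp
        ring
      · subst h
        rw [if_neg (by omega), if_pos le_rfl, if_pos le_rfl, Nat.sub_self, Nat.sub_self, qFac_succ,
          qFac_zero, Nat.choose_succ_succ' k 1, Nat.choose_one_right, pow_add q k]
        field_simp
        ring
      · rw [if_neg (by omega), if_neg (by omega), if_neg (by omega)]
        simp

lemma prod_one_add_mul_pow {q : ℂ} (hq : ‖q‖ < 1) (n : ℕ) (y : ℂ) :
    ∏ i ∈ Finset.range n, (1 + y * q ^ i) =
      ∑ k ∈ Finset.range (n + 1),
        q ^ k.choose 2 * qFac q n / (qFac q k * qFac q (n - k)) * y ^ k := by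
  have hdeg : (∏ i ∈ Finset.range n, (1 + C (q ^ i) * X)).natDegree < n + 1 := by
    refine Nat.lt_succ_of_le ((natDegree_prod_le _ _).trans ?_)
    refine (Finset.sum_le_card_nsmul _ _ 1 fun i _ ↦ ?_).trans (by simp)
    rw [add_comm, ← C_1]
    exact natDegree_linear_le
  have h := eval_eq_sum_range' hdeg y
  rw [eval_prod] at h
  simp only [eval_add, eval_one, eval_mul, eval_C, eval_X] at h
  rw [Finset.prod_congr rfl fun i _ ↦ by rw [mul_comm y], h]
  refine Finset.sum_congr rfl fun k hk ↦ ?_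
  rw [coeff_prod_one_add_pow_mul_X hq, if_pos (by simpa [Nat.lt_succ_iff] using hk)]

/-- The generating polynomial of the pairs of subsets of `{1, …, N}`, by shifted rank. -/
noncomputable def rankPoly (q : ℂ) (N : ℕ) : ℂ[X] :=
  ∏ i ∈ Finset.Icc 1 N, ((1 + C (q ^ i) * X) * (X + C (q ^ i)))

lemma one_add_X_mul_rankPoly {q : ℂ} (hq0 : q ≠ 0) (N : ℕ) :
    (1 + X) * rankPoly q N = C (q ^ (N + 1).choose 2) *
      ∏ i ∈ Finset.range (2 * N + 1), (1 + C (q ^ i) * (C (q⁻¹ ^ N) * X)) := by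
  induction N with
  | zero => simp [rankPoly]
  | succ N ih =>
    have h1 : rankPoly q (N + 1) =
        rankPoly q N * ((1 + C (q ^ (N + 1)) * X) * (X + C (q ^ (N + 1)))) :=
      Finset.prod_Icc_succ_top (by omega) _
    rw [h1, ← mul_assoc, ih, show 2 * (N + 1) + 1 = (2 * N + 1) + 1 + 1 by ring,
      Finset.prod_range_succ _ (2 * N + 1 + 1), Finset.prod_range_succ' _ (2 * N + 1),
      Nat.choose_succ_succ' (N + 1) 1,
      Nat.choose_one_right, pow_add q (N + 1), C_mul]
    have h2 : ∀ i, (1 + C (q ^ (i + 1)) * (C (q⁻¹ ^ (N + 1)) * X) : ℂ[X]) =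
        1 + C (q ^ i) * (C (q⁻¹ ^ N) * X) := by
      intro i
      rw [← mul_assoc, ← C_mul, ← mul_assoc, ← C_mul, pow_succ, pow_succ,
        mul_mul_mul_comm, mul_comm q, inv_mul_cancel₀ hq0, mul_one]
    have h3 : (C (q ^ (2 * N + 1 + 1)) * (C (q⁻¹ ^ (N + 1)) * X) : ℂ[X]) = C (q ^ (N + 1)) * X := by
      rw [← mul_assoc, ← C_mul, show 2 * N + 1 + 1 = (N + 1) + (N + 1) by ring, pow_add, mul_assoc,
        ← mul_pow, mul_inv_cancel₀ hq0, one_pow, mul_one]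
    have h4 : (C (q ^ (N + 1)) * (1 + C (q ^ 0) * (C (q⁻¹ ^ (N + 1)) * X)) : ℂ[X]) =
        X + C (q ^ (N + 1)) := by
      rw [pow_zero, C_1, one_mul, mul_add, mul_one, ← mul_assoc, ← C_mul, ← mul_pow,
        mul_inv_cancel₀ hq0, one_pow, C_1, one_mul, add_comm]
    rw [h3, Finset.prod_congr rfl fun i _ ↦ h2 i, ← h4]
    ring

lemma choose_two_identity (N m : ℕ) :
    (N + 1).choose 2 + (N + m).choose 2 = N * (N + m) + m.choose 2 := by
  have h : ∀ n : ℕ, (n.choose 2 : ℤ) * 2 = n * (n - 1) := by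
    intro n
    induction n with
    | zero => simp
    | succ n ih =>
      rw [Nat.choose_succ_succ' n 1, Nat.choose_one_right]
      push_cast
      linarith
  have h1 := h (N + 1)
  have h2 := h (N + m)
  have h3 := h m
  zify
  push_cast at h1 h2
  linarith

lemma coeff_one_add_X_mul_rankPoly {q : ℂ} (hq : ‖q‖ < 1) (hq0 : q ≠ 0) (N m : ℕ) :
    ((1 + X) * rankPoly q N).coeff (N + m) = if m ≤ N + 1 then
      q ^ m.choose 2 * qFac q (2 * N + 1) / (qFac q (N + m) * qFac q (N + 1 - m)) else 0 := by
  have hcomp : ∏ i ∈ Finset.range (2 * N + 1), (1 + C (q ^ i) * (C (q⁻¹ ^ N) * X)) =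
      (∏ i ∈ Finset.range (2 * N + 1), (1 + C (q ^ i) * X)).comp (C (q⁻¹ ^ N) * X) := by
    rw [prod_comp]
    simp
  rw [one_add_X_mul_rankPoly hq0, coeff_C_mul, hcomp, comp_C_mul_X_coeff,
    coeff_prod_one_add_pow_mul_X hq]
  by_cases h : m ≤ N + 1
  · rw [if_pos h, if_pos (by omega), show 2 * N + 1 - (N + m) = N + 1 - m by omega]
    have hp : q ^ (N + 1).choose 2 * q ^ (N + m).choose 2 * (q⁻¹ ^ N) ^ (N + m) =
        q ^ m.choose 2 := by
      rw [← pow_add, choose_two_identity, ← pow_mul, inv_pow, pow_add]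
      field_simp
    rw [← hp]
    ring
  · rw [if_neg h, if_neg (by omega)]
    simp

lemma coeff_rankPoly (q : ℂ) (N m : ℕ) :
    (rankPoly q N).coeff (N + m) =
      ∑ p ∈ (Finset.Icc 1 N).powerset ×ˢ (Finset.Icc 1 N).powerset,
        if (p.2.card : ℤ) - p.1.card = m then q ^ (∑ i ∈ p.1, i + ∑ i ∈ p.2, i) else 0 := by
  have h1 : ∏ i ∈ Finset.Icc 1 N, (1 + C (q ^ i) * X) =
      ∑ B ∈ (Finset.Icc 1 N).powerset, C (q ^ ∑ i ∈ B, i) * X ^ B.card := by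
    rw [Finset.prod_one_add]
    refine Finset.sum_congr rfl fun B _ ↦ ?_
    rw [Finset.prod_mul_distrib, Finset.prod_const, ← Finset.prod_pow_eq_pow_sum, map_prod]
  have h2 : ∏ i ∈ Finset.Icc 1 N, (X + C (q ^ i)) =
      ∑ A ∈ (Finset.Icc 1 N).powerset, C (q ^ ∑ i ∈ A, i) * X ^ (N - A.card) := by
    rw [Finset.prod_congr rfl fun i _ ↦ add_comm X (C (q ^ i)), Finset.prod_add]
    refine Finset.sum_congr rfl fun A hA ↦ ?_
    rw [Finset.prod_const, ← Finset.prod_pow_eq_pow_sum, map_prod,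
      Finset.card_sdiff_of_subset (Finset.mem_powerset.mp hA), Nat.card_Icc, Nat.add_sub_cancel]
  rw [rankPoly, Finset.prod_mul_distrib, h1, h2, mul_comm, Finset.sum_mul_sum,
    ← Finset.sum_product', finsetSum_coeff]
  refine Finset.sum_congr rfl fun p hp ↦ ?_
  have hA : p.1.card ≤ N := by
    simpa using Finset.card_le_card (Finset.mem_powerset.mp (Finset.mem_product.mp hp).1)
  rw [show C (q ^ ∑ i ∈ p.1, i) * X ^ (N - p.1.card) * (C (q ^ ∑ i ∈ p.2, i) * X ^ p.2.card) =
    C (q ^ (∑ i ∈ p.1, i + ∑ i ∈ p.2, i)) * X ^ (N - p.1.card + p.2.card) by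
      rw [pow_add, C_mul, pow_add]; ring, coeff_C_mul_X_pow]
  refine if_congr ?_ rfl rfl
  omega

end QBinomial

/-- Euler's evaluation of `∑ q ^ (l (k + 1)) / (q)_l`. -/
lemma hasSum_pow_div_qFac {q : ℂ} (hq : ‖q‖ < 1) (k : ℕ) :
    HasSum (fun l ↦ q ^ (l * (k + 1)) / qFac q l) (qFac q k / eulerProd q) := by
  obtain ⟨M, hM⟩ := exists_norm_inv_qFac_le hq
  have hM0 : 0 ≤ M := (norm_nonneg _).trans (hM 0)
  have hbd : ∀ k l, ‖q ^ (l * (k + 1)) / qFac q l‖ ≤ M * ‖q‖ ^ l := by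
    intro k l
    rw [div_eq_mul_inv, norm_mul, norm_pow, mul_comm]
    refine mul_le_mul (hM l) (pow_le_pow_of_le_one (norm_nonneg _) hq.le ?_) (by positivity) hM0
    nlinarith
  have hgeo : Summable fun l ↦ M * ‖q‖ ^ l :=
    (summable_geometric_of_lt_one (norm_nonneg _) hq).mul_left M
  have hs : ∀ k, Summable fun l ↦ q ^ (l * (k + 1)) / qFac q l := fun k ↦
    Summable.of_norm_bounded hgeo (hbd k)
  set E : ℕ → ℂ := fun k ↦ ∑' l, q ^ (l * (k + 1)) / qFac q l with hE
  have hrec : ∀ k, E (k + 1) = (1 - q ^ (k + 1)) * E k := by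
    intro k
    have h1 : E k - E (k + 1) = q ^ (k + 1) * E k := by
      simp only [hE]
      rw [← (hs k).tsum_sub (hs (k + 1)), ← tsum_mul_left,
        ((hs k).sub (hs (k + 1))).tsum_eq_zero_add]
      simp only [zero_mul, pow_zero, sub_self, zero_add]
      refine tsum_congr fun l ↦ ?_
      have e1 := qFac_ne_zero hq l
      have e2 := one_sub_pow_succ_ne_zero hq l
      have e3 : q ^ ((l + 1) * (k + 1 + 1)) = q ^ (l * (k + 1)) * q ^ (k + 1) * q ^ (l + 1) := by
        ring
      have e4 : q ^ ((l + 1) * (k + 1)) = q ^ (l * (k + 1)) * q ^ (k + 1) := by ring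
      rw [e3, e4, qFac_succ]
      generalize q ^ (l + 1) = c at *
      field_simp
    linear_combination -h1
  have hmul : ∀ k, E k = qFac q k * E 0 := by
    intro k
    induction k with
    | zero => simp [qFac_zero]
    | succ k ih => rw [hrec, ih, qFac_succ]; ring
  have hlim : Tendsto E atTop (𝓝 1) := by
    have h1 : (1 : ℂ) = ∑' l : ℕ, if l = 0 then 1 else 0 := by simp
    rw [h1]
    refine tendsto_tsum_of_dominated_convergence hgeo (fun l ↦ ?_)
      (Eventually.of_forall fun k l ↦ hbd k l)
    rcases l with _ | l
    · simp [qFac_zero]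
    · have h2 := (tendsto_pow_atTop_nhds_zero_of_norm_lt_one
        (x := q ^ (l + 1)) (by rw [norm_pow]; exact pow_lt_one₀ (norm_nonneg _) hq l.succ_ne_zero))
      have h3 := ((tendsto_add_atTop_iff_nat 1).mpr h2).div_const (qFac q (l + 1))
      simpa [← pow_mul] using h3
  have hE0 : eulerProd q * E 0 = 1 :=
    tendsto_nhds_unique ((tendsto_qFac hq).mul_const (E 0)) (hlim.congr hmul)
  have : E k = qFac q k / eulerProd q := by
    rw [hmul, div_eq_mul_inv, ← eq_inv_of_mul_eq_one_right hE0]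
  rw [← this]
  exact (hs k).hasSum

namespace UnimodalData

lemma prod_one_add_pow_le {r : ℝ} (h0 : 0 ≤ r) (h1 : r < 1) (N : ℕ) :
    ∏ i ∈ Finset.Icc 1 N, (1 + r ^ i) ≤ Real.exp (1 - r)⁻¹ := by
  calc ∏ i ∈ Finset.Icc 1 N, (1 + r ^ i) ≤ ∏ i ∈ Finset.Icc 1 N, Real.exp (r ^ i) :=
        Finset.prod_le_prod (fun i _ ↦ by positivity) fun i _ ↦ by
          linarith [Real.add_one_le_exp (r ^ i)]
    _ = Real.exp (∑ i ∈ Finset.Icc 1 N, r ^ i) := (Real.exp_sum _ _).symm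
    _ ≤ _ := by
      rw [Real.exp_le_exp, ← tsum_geometric_of_lt_one h0 h1]
      exact (summable_geometric_of_lt_one h0 h1).sum_le_tsum _ fun i _ ↦ by positivity

lemma sum_pow_size {R : Type*} [CommSemiring R] (r : R) (N : ℕ) :
    ∑ p : ↥((Finset.Icc 1 N).powerset ×ˢ (Finset.Icc 1 N).powerset),
      r ^ size ⟨N, p⟩ = r ^ (N + 1) * (∏ i ∈ Finset.Icc 1 N, (1 + r ^ i)) ^ 2 := by
  have h := Finset.sum_coe_sort ((Finset.Icc 1 N).powerset ×ˢ (Finset.Icc 1 N).powerset)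
    fun p ↦ r ^ (N + 1 + ∑ i ∈ p.1, i + ∑ i ∈ p.2, i)
  refine h.trans ?_
  rw [Finset.prod_one_add, sq, Finset.sum_mul_sum, ← Finset.sum_product', Finset.mul_sum]
  refine Finset.sum_congr rfl fun p _ ↦ ?_
  rw [Finset.prod_pow_eq_pow_sum, Finset.prod_pow_eq_pow_sum, pow_add, pow_add]
  ring

lemma summable_pow_size {r : ℝ} (h0 : 0 ≤ r) (h1 : r < 1) :
    Summable fun t : UnimodalData ↦ r ^ t.size := by
  rw [summable_sigma_of_nonneg fun t ↦ by positivity]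
  refine ⟨fun N ↦ (hasSum_fintype _).summable, ?_⟩
  simp only [tsum_fintype]
  refine Summable.of_nonneg_of_le (fun N ↦ Finset.sum_nonneg fun p _ ↦ by positivity) (fun N ↦ ?_)
    (((summable_nat_add_iff 1).mpr (summable_geometric_of_lt_one h0 h1)).mul_right
      (Real.exp (1 - r)⁻¹ ^ 2))
  rw [sum_pow_size]
  have := prod_one_add_pow_le h0 h1 N
  have h2 : 0 ≤ ∏ i ∈ Finset.Icc 1 N, (1 + r ^ i) := Finset.prod_nonneg fun i _ ↦ by positivity
  gcongr

/-- The generating function of the strongly unimodal sequences of rank `m`. -/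
noncomputable def rankGen (m : ℤ) (q : ℂ) : ℂ :=
  ∑' t : UnimodalData, if t.rank = m then q ^ t.size else 0

lemma norm_ite_le (m : ℤ) (q : ℂ) (t : UnimodalData) :
    ‖if t.rank = m then q ^ t.size else 0‖ ≤ ‖q‖ ^ t.size := by
  split_ifs
  · rw [norm_pow]
  · rw [norm_zero]; positivity

lemma hasSum_rankGen (m : ℤ) {q : ℂ} (hq : ‖q‖ < 1) :
    HasSum (fun t : UnimodalData ↦ if t.rank = m then q ^ t.size else 0) (rankGen m q) :=
  (Summable.of_norm_bounded (summable_pow_size (norm_nonneg q) hq) (norm_ite_le m q)).hasSum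

lemma hasSum_unimodalCount (m : ℤ) {q : ℂ} (hq : ‖q‖ < 1) :
    HasSum (fun n ↦ (unimodalCount m n : ℂ) * q ^ n) (rankGen m q) := by
  have h := (Equiv.sigmaFiberEquiv size).hasSum_iff.mpr (hasSum_rankGen m hq)
  refine h.sigma fun n ↦ ?_
  classical
  have := Fintype.ofFinite {t : UnimodalData // t.size = n}
  have h2 := hasSum_fintype fun t : {t : UnimodalData // t.size = n} ↦
    if t.1.rank = m then q ^ t.1.size else 0
  have h3 : ∀ t : {t : UnimodalData // t.size = n}, (if t.1.rank = m then q ^ t.1.size else 0) =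
      if t.1.rank = m then q ^ n else 0 := fun t ↦ by rw [t.2]
  have h4 : (∑ t : {t : UnimodalData // t.size = n}, if t.1.rank = m then q ^ t.1.size else 0) =
      unimodalCount m n * q ^ n := by
    simp only [h3]
    rw [← Finset.sum_filter, Finset.sum_const, nsmul_eq_mul, unimodalCount_eq]
    congr 2
    rw [← Fintype.card_subtype, ← Nat.card_eq_fintype_card]
    exact Nat.card_congr (Equiv.subtypeSubtypeEquivSubtypeInter
      (fun t : UnimodalData ↦ t.size = n) fun t ↦ t.rank = m)
  rw [← h4]
  exact h2

lemma tendsto_rankGen {q : ℂ} (hq : ‖q‖ < 1) :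
    Tendsto (fun m : ℕ ↦ rankGen m q) atTop (𝓝 0) := by
  have h := tendsto_tsum_of_dominated_convergence (𝓕 := atTop)
    (f := fun (m : ℕ) (t : UnimodalData) ↦ if t.rank = m then q ^ t.size else 0)
    (g := fun _ ↦ 0) (summable_pow_size (norm_nonneg q) hq) (fun t ↦ ?_)
    (Eventually.of_forall fun m t ↦ norm_ite_le m q t)
  · simpa [rankGen] using h
  · refine tendsto_const_nhds.congr' ?_
    filter_upwards [eventually_gt_atTop t.rank.toNat] with m hm
    rw [if_neg (by omega)]

lemma hasSum_rankGen_coeff (m : ℕ) {q : ℂ} (hq : ‖q‖ < 1) :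
    HasSum (fun N ↦ q ^ (N + 1) * (rankPoly q N).coeff (N + m)) (rankGen m q) := by
  refine (hasSum_rankGen m hq).sigma fun N ↦ ?_
  convert hasSum_fintype _ using 1
  have h := Finset.sum_coe_sort ((Finset.Icc 1 N).powerset ×ˢ (Finset.Icc 1 N).powerset)
    fun p ↦ if (p.2.card : ℤ) - p.1.card = m then
      q ^ (N + 1 + ∑ i ∈ p.1, i + ∑ i ∈ p.2, i) else 0
  refine Eq.trans ?_ h.symm
  rw [coeff_rankPoly, Finset.mul_sum]
  refine Finset.sum_congr rfl fun p _ ↦ ?_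
  rw [mul_ite, mul_zero, ← pow_add, add_assoc (N + 1)]

lemma hasSum_rankGen_add (μ : ℕ) {q : ℂ} (hq : ‖q‖ < 1) (hq0 : q ≠ 0) :
    HasSum (fun n ↦ q ^ (n + μ + 1) * (q ^ (μ + 1).choose 2 * qFac q (2 * (n + μ) + 1) /
      (qFac q (n + 2 * μ + 1) * qFac q n))) (rankGen μ q + rankGen (μ + 1 : ℕ) q) := by
  have h1 := (hasSum_rankGen_coeff μ hq).add (hasSum_rankGen_coeff (μ + 1) hq)
  have h2 : ∀ N, q ^ (N + 1) * (rankPoly q N).coeff (N + μ) +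
      q ^ (N + 1) * (rankPoly q N).coeff (N + (μ + 1)) = q ^ (N + 1) *
      if μ + 1 ≤ N + 1 then q ^ (μ + 1).choose 2 * qFac q (2 * N + 1) /
        (qFac q (N + (μ + 1)) * qFac q (N + 1 - (μ + 1))) else 0 := by
    intro N
    rw [← coeff_one_add_X_mul_rankPoly hq hq0, add_mul, one_mul, Polynomial.coeff_add,
      ← add_assoc, Polynomial.coeff_X_mul]
    ring
  simp only [h2] at h1
  have h3 := (hasSum_nat_add_iff' μ).mpr h1
  rw [Finset.sum_eq_zero, sub_zero] at h3
  · refine h3.congr_fun ?_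
    intro n
    rw [if_pos (by omega), show n + μ + (μ + 1) = n + 2 * μ + 1 by ring,
      show n + μ + 1 - (μ + 1) = n by omega]
  · intro N hN
    rw [if_neg (by simp at hN; omega), mul_zero]

lemma rankGen_term_eq (μ : ℕ) {q : ℂ} (hq : ‖q‖ < 1) (n : ℕ) :
    q ^ (n + μ + 1) * (q ^ (μ + 1).choose 2 * qFac q (2 * (n + μ) + 1) /
      (qFac q (n + 2 * μ + 1) * qFac q n)) =
    ∑ k ∈ Finset.range (n + 1), (-1) ^ k * q ^ ((μ + 2).choose 2 + k.choose 2 +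
      k * (n + 2 * μ + 2) + n) / (qFac q k * qFac q (n - k)) := by
  have h1 : qFac q (2 * (n + μ) + 1) = qFac q (n + 2 * μ + 1) *
      ∏ i ∈ Finset.range n, (1 + -q ^ (n + 2 * μ + 2) * q ^ i) := by
    rw [show 2 * (n + μ) + 1 = n + 2 * μ + 1 + n by ring, qFac_add]
    congr 1
    refine Finset.prod_congr rfl fun i _ ↦ ?_
    rw [neg_mul, ← pow_add, ← sub_eq_add_neg]
    congr 2; ring
  have h2 := qFac_ne_zero hq (n + 2 * μ + 1)
  have h3 := qFac_ne_zero hq n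
  rw [h1, prod_one_add_mul_pow hq, show q ^ (n + μ + 1) * (q ^ (μ + 1).choose 2 *
    (qFac q (n + 2 * μ + 1) * ∑ k ∈ Finset.range (n + 1), q ^ k.choose 2 * qFac q n /
      (qFac q k * qFac q (n - k)) * (-q ^ (n + 2 * μ + 2)) ^ k) /
    (qFac q (n + 2 * μ + 1) * qFac q n)) = q ^ (n + μ + 1) * q ^ (μ + 1).choose 2 / qFac q n *
      ∑ k ∈ Finset.range (n + 1), q ^ k.choose 2 * qFac q n /
      (qFac q k * qFac q (n - k)) * (-q ^ (n + 2 * μ + 2)) ^ k by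
    generalize (∑ k ∈ Finset.range (n + 1), q ^ k.choose 2 * qFac q n /
      (qFac q k * qFac q (n - k)) * (-q ^ (n + 2 * μ + 2)) ^ k) = T
    field_simp, Finset.mul_sum]
  refine Finset.sum_congr rfl fun k _ ↦ ?_
  have h4 := qFac_ne_zero hq k
  have h5 := qFac_ne_zero hq (n - k)
  rw [Nat.choose_succ_succ' (μ + 1) 1, Nat.choose_one_right, neg_pow, ← pow_mul]
  field_simp
  ring

/-- The generating functions of two consecutive ranks add up to a partial theta function divided
by the Euler product. -/
lemma rankGen_add_rankGen (μ : ℕ) {q : ℂ} (hq : ‖q‖ < 1) (hq0 : q ≠ 0) :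
    HasSum (fun k : ℕ ↦ (-1) ^ k * q ^ ((μ + 2).choose 2 + k.choose 2 + k * (k + 2 * μ + 2) + k) /
      eulerProd q) (rankGen μ q + rankGen (μ + 1 : ℕ) q) := by
  obtain ⟨M, hM⟩ := exists_norm_inv_qFac_le hq
  have hM0 : 0 ≤ M := (norm_nonneg _).trans (hM 0)
  set f : ℕ × ℕ → ℂ := fun p ↦ (-1) ^ p.1 * q ^ ((μ + 2).choose 2 + p.1.choose 2 +
      p.1 * (p.1 + p.2 + 2 * μ + 2) + (p.1 + p.2)) / (qFac q p.1 * qFac q p.2) with hf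
  have hgeo := summable_geometric_of_lt_one (norm_nonneg q) hq
  have hsum : Summable f := by
    refine Summable.of_norm_bounded (g := fun p ↦ M * M * (‖q‖ ^ p.1 * ‖q‖ ^ p.2))
      ((hgeo.mul_of_nonneg hgeo (fun _ ↦ by positivity) fun _ ↦ by positivity).mul_left _) fun p ↦ ?_
    simp only [hf]
    rw [div_eq_mul_inv, mul_inv, norm_mul, norm_mul, norm_mul, norm_pow, norm_pow, norm_neg,
      norm_one, one_pow, one_mul, mul_comm, ← pow_add]
    refine mul_le_mul (mul_le_mul (hM _) (hM _) (norm_nonneg _) hM0)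
      (pow_le_pow_of_le_one (norm_nonneg _) hq.le (by omega)) (by positivity) (by positivity)
  have h1 : HasSum (fun n ↦ ∑ p ∈ Finset.HasAntidiagonal.antidiagonal n, f p) (∑' p, f p) := by
    have := (Finset.HasAntidiagonal.sigmaAntidiagonalEquivProd (A := ℕ)).hasSum_iff.mpr hsum.hasSum
    refine this.sigma fun n ↦ ?_
    rw [← Finset.sum_coe_sort]
    exact hasSum_fintype _
  have h2 : ∑' p, f p = rankGen μ q + rankGen (μ + 1 : ℕ) q := by
    refine h1.unique ?_
    refine (hasSum_rankGen_add μ hq hq0).congr_fun fun n ↦ ?_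
    rw [rankGen_term_eq μ hq, Finset.Nat.sum_antidiagonal_eq_sum_range_succ_mk]
    refine Finset.sum_congr rfl fun k hk ↦ ?_
    have : k + (n - k) = n := by simp at hk; omega
    simp only [hf, this]
  rw [← h2]
  refine hsum.hasSum.prod_fiberwise fun k ↦ ?_
  have h3 := (hasSum_pow_div_qFac hq k).mul_left ((-1) ^ k * q ^ ((μ + 2).choose 2 + k.choose 2 +
    k * (k + 2 * μ + 2) + k) / qFac q k)
  have hk := qFac_ne_zero hq k
  have he := eulerProd_ne_zero hq
  have e1 : (fun l ↦ f (k, l)) = fun l ↦ (-1) ^ k * q ^ ((μ + 2).choose 2 + k.choose 2 +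
      k * (k + 2 * μ + 2) + k) / qFac q k * (q ^ (l * (k + 1)) / qFac q l) := by
    ext l
    have hl := qFac_ne_zero hq l
    simp only [hf]
    field_simp
    ring
  rw [div_mul_div_cancel₀ hk] at h3
  rw [e1]
  exact h3

lemma natCast_choose_two (n : ℕ) : ((n.choose 2 : ℕ) : ℂ) = n * (n - 1) / 2 := by
  induction n with
  | zero => simp
  | succ n ih =>
    rw [Nat.choose_succ_succ' n 1, Nat.choose_one_right]
    push_cast
    rw [ih]; ring

/-- The rank generating function with the partition generating function divided out. -/
noncomputable def reducedGen (m : ℕ) (q : ℂ) : ℂ := eulerProd q * rankGen m q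

lemma hasSum_reducedGen_add (μ : ℕ) {q : ℂ} (hq : ‖q‖ < 1) (hq0 : q ≠ 0) :
    HasSum (fun k : ℕ ↦ (-1) ^ k * q ^ ((μ + 2).choose 2 + k.choose 2 + k * (k + 2 * μ + 2) + k))
      (reducedGen μ q + reducedGen (μ + 1) q) := by
  have h := (rankGen_add_rankGen μ hq hq0).mul_left (eulerProd q)
  rw [mul_add] at h
  refine h.congr_fun fun k ↦ ?_
  rw [mul_div_cancel₀ _ (eulerProd_ne_zero hq)]

lemma reducedGen_add_exp (μ : ℕ) {z : ℂ} (hz : 0 < z.re) :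
    reducedGen μ (exp (-z)) + reducedGen (μ + 1) (exp (-z)) = partialTheta z (μ + 1) := by
  rw [partialTheta, ← (hasSum_reducedGen_add μ (norm_exp_neg_lt_one hz) (exp_ne_zero _)).tsum_eq]
  refine tsum_congr fun k ↦ ?_
  rw [thetaTerm, ← exp_nat_mul]
  congr 2
  push_cast
  rw [natCast_choose_two, natCast_choose_two]
  push_cast
  ring

lemma tendsto_reducedGen (m : ℕ) {q : ℂ} (hq : ‖q‖ < 1) :
    Tendsto (fun j : ℕ ↦ reducedGen (m + j) q) atTop (𝓝 0) := by
  have h := ((tendsto_rankGen hq).const_mul (eulerProd q)).comp (tendsto_add_atTop_nat m)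
  rw [mul_zero] at h
  refine h.congr fun j ↦ ?_
  simp only [Function.comp, reducedGen, add_comm]

lemma norm_reducedGen_le (m : ℕ) {q : ℂ} (hq : ‖q‖ < 1) (hq0 : q ≠ 0) :
    ‖reducedGen m q‖ ≤ 1 / (1 - ‖q‖) ^ 2 := by
  have hgeo := hasSum_geometric_of_lt_one (norm_nonneg q) hq
  have hb : ∀ j, ‖reducedGen (m + j) q + reducedGen (m + (j + 1)) q‖ ≤
      (1 - ‖q‖)⁻¹ * ‖q‖ ^ j := by
    intro j
    rw [← add_assoc m j 1, ← (hasSum_reducedGen_add (m + j) hq hq0).tsum_eq, mul_comm _ (‖q‖ ^ j)]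
    refine tsum_of_norm_bounded (hgeo.mul_left (‖q‖ ^ j)) fun k ↦ ?_
    rw [norm_mul, norm_pow, norm_neg, norm_one, one_pow, one_mul, norm_pow, ← pow_add]
    refine pow_le_pow_of_le_one (norm_nonneg _) hq.le ?_
    have : (m + j + 2).choose 2 = m + j + 1 + (m + j + 1).choose 2 := by
      rw [Nat.choose_succ_succ' (m + j + 1) 1, Nat.choose_one_right]
    omega
  have hs := hgeo.mul_left (1 - ‖q‖)⁻¹
  have hsum : Summable fun j ↦ ‖reducedGen (m + j) q + reducedGen (m + (j + 1)) q‖ :=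
    Summable.of_nonneg_of_le (fun _ ↦ norm_nonneg _) hb hs.summable
  have h := norm_le_tsum_of_add_succ (S := fun j ↦ reducedGen (m + j) q) (fun k ↦ rfl)
    (tendsto_reducedGen m hq) hsum
  refine h.trans ((hsum.tsum_le_tsum hb hs.summable).trans_eq ?_)
  rw [hs.tsum_eq, one_div, sq, mul_inv]

lemma reducedGen_sub_isLittleO (m : ℕ) :
    (fun z ↦ reducedGen m (exp (-z)) - (1 / 4 - z * linearCoeff (m + 1))) =o[coneFilter]
      fun z : ℂ ↦ z := by
  refine sub_linear_isLittleO (m + 1) (S := fun z j ↦ reducedGen (m + j) (exp (-z)))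
    (fun z hz j ↦ ?_) fun z hz ↦ tendsto_reducedGen m (norm_exp_neg_lt_one hz)
  rw [← add_assoc, reducedGen_add_exp _ hz, add_right_comm]

/-- The leading asymptotic of the number of partitions of `n`. -/
noncomputable def partitionScale (n : ℕ) : ℝ :=
  1 / (4 * √3 * n) * Real.exp (Real.pi * √(2 * n / 3))

lemma partitionScale_pos {n : ℕ} (hn : n ≠ 0) : 0 < partitionScale n := by
  have : (0 : ℝ) < n := by positivity
  unfold partitionScale
  positivity

lemma tendsto_unimodalCount_nat (m : ℕ) :
    Tendsto (fun n ↦ (unimodalCount m n : ℝ) / partitionScale n) atTop (𝓝 (1 / 4)) := by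
  have h := tendsto_coeff_div (a := fun n ↦ (unimodalCount m n : ℝ)) (F := reducedGen m) (β := 0)
    (K := 2) (c := 1 / 4) (C := 1) zero_le_one (fun q hq _ ↦ ?_)
    (fun q hq hq0 ↦ norm_reducedGen_le m hq hq0) ?_
  · simpa [partitionScale] using h
  · have := hasSum_unimodalCount m hq
    rw [reducedGen, mul_div_cancel_left₀ _ (eulerProd_ne_zero hq)]
    exact_mod_cast this
  · have h1 := (reducedGen_sub_isLittleO m).trans_tendsto tendsto_cone_id
    have h2 : Tendsto (fun z : ℂ ↦ 1 / 4 - z * linearCoeff (m + 1)) coneFilter (𝓝 (1 / 4)) := by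
      simpa using tendsto_const_nhds.sub (tendsto_cone_id.mul_const (linearCoeff (m + 1)))
    simpa using h1.add h2

lemma tendsto_unimodalCount_sub_nat (m : ℕ) :
    Tendsto (fun n ↦ ((unimodalCount m n : ℝ) - unimodalCount (m + 1) n) /
      (partitionScale n * saddle n)) atTop (𝓝 ((2 * m + 1) / 8)) := by
  have h := tendsto_coeff_div (a := fun n ↦ (unimodalCount m n : ℝ) - unimodalCount (m + 1) n)
    (F := fun q ↦ reducedGen m q - reducedGen (m + 1) q) (β := 1)
    (K := 2) (c := (2 * m + 1) / 8) (C := 2) zero_le_two (fun q hq _ ↦ ?_)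
    (fun q hq hq0 ↦ ?_) ?_
  · simpa [partitionScale] using h
  · have h1 := (hasSum_unimodalCount m hq).sub (hasSum_unimodalCount (m + 1) hq)
    have h2 : (reducedGen m q - reducedGen (m + 1) q) / eulerProd q =
        rankGen m q - rankGen (m + 1) q := by
      rw [reducedGen, reducedGen, ← mul_sub, mul_div_cancel_left₀ _ (eulerProd_ne_zero hq)]
      push_cast; rfl
    rw [h2]
    refine h1.congr_fun fun n ↦ ?_
    push_cast
    ring
  · refine (norm_sub_le _ _).trans ?_
    have h1 := norm_reducedGen_le m hq hq0
    have h2 := norm_reducedGen_le (m + 1) hq hq0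
    calc _ ≤ 1 / (1 - ‖q‖) ^ 2 + 1 / (1 - ‖q‖) ^ 2 := add_le_add h1 h2
      _ = _ := by ring
  · have h1 := ((reducedGen_sub_isLittleO m).sub
      (reducedGen_sub_isLittleO (m + 1))).tendsto_div_nhds_zero.add_const
      ((2 * m + 1 : ℂ) / 8)
    rw [zero_add] at h1
    have e : (((2 * m + 1) / 8 : ℝ) : ℂ) = (2 * m + 1) / 8 := by push_cast; rfl
    rw [e]
    refine h1.congr' ?_
    filter_upwards [coneFilter_mem] with z hz
    have hz0 : z ≠ 0 := by rintro rfl; simp at hz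
    rw [← linearCoeff_succ_sub, pow_one]
    field_simp
    ring

lemma tendsto_unimodalCount (m : ℤ) :
    Tendsto (fun n ↦ (unimodalCount m n : ℝ) / partitionScale n) atTop (𝓝 (1 / 4)) := by
  obtain ⟨k, rfl | rfl⟩ := m.eq_nat_or_neg
  · exact tendsto_unimodalCount_nat k
  · simpa only [unimodalCount_neg] using tendsto_unimodalCount_nat k

lemma tendsto_unimodalCount_sub (m : ℤ) :
    Tendsto (fun n ↦ ((unimodalCount m n : ℝ) - unimodalCount (m + 1) n) /
      (partitionScale n * saddle n)) atTop (𝓝 ((2 * m + 1) / 8)) := by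
  rcases m with k | k
  · simpa using tendsto_unimodalCount_sub_nat k
  · have h := (tendsto_unimodalCount_sub_nat k).neg
    rw [Int.negSucc_eq]
    have e : -((k : ℤ) + 1) + 1 = -k := by ring
    rw [e]
    simp only [unimodalCount_neg]
    have e2 : (2 * ((-((k : ℤ) + 1) : ℤ) : ℝ) + 1) / 8 = -((2 * (k : ℝ) + 1) / 8) := by
      push_cast; ring
    rw [e2]
    refine h.congr fun n ↦ ?_
    ring

lemma tendsto_logConcavity (m : ℤ) :
    Tendsto (fun n ↦ ((unimodalCount m n : ℝ) ^ 2 -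
      unimodalCount (m - 1) n * unimodalCount (m + 1) n) /
      (partitionScale n ^ 2 * saddle n)) atTop (𝓝 (1 / 16)) := by
  have h0 := tendsto_unimodalCount m
  have h1 := tendsto_unimodalCount_sub m
  have h2 := tendsto_unimodalCount_sub (m - 1)
  rw [sub_add_cancel] at h2
  have hs : Tendsto saddle atTop (𝓝 0) := tendsto_saddle.mono_right nhdsWithin_le_nhds
  have h := (h0.mul (h1.sub h2)).add ((h1.mul h2).mul hs)
  have e : 1 / 4 * ((2 * (m : ℝ) + 1) / 8 - (2 * ((m - 1 : ℤ) : ℝ) + 1) / 8) +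
      (2 * (m : ℝ) + 1) / 8 * ((2 * ((m - 1 : ℤ) : ℝ) + 1) / 8) * 0 = 1 / 16 := by
    push_cast; ring
  rw [e] at h
  refine h.congr' ?_
  filter_upwards [eventually_ne_atTop 0] with n hn
  have hx := (saddle_pos hn).ne'
  have hA := (partitionScale_pos hn).ne'
  field_simp
  ring

end UnimodalData

end

theorem theorem1p5 :
    (∀ m : ℕ,
      Asymptotics.IsEquivalent Filter.atTop
        (fun n : ℕ => (unimodalCount m n : ℝ))
        (fun n : ℕ => 1 / (16 * √3 * (n : ℝ)) * Real.exp (Real.pi * √(2 * (n : ℝ) / 3))) ∧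
      Asymptotics.IsEquivalent Filter.atTop
        (fun n : ℕ => (unimodalCount m n : ℝ) - (unimodalCount (m + 1) n : ℝ))
        (fun n : ℕ => Real.pi * (2 * (m : ℝ) + 1) / (96 * √2 * (n : ℝ) ^ (3 / 2 : ℝ)) *
          Real.exp (Real.pi * √(2 * (n : ℝ) / 3))) ∧
      Asymptotics.IsEquivalent Filter.atTop
        (fun n : ℕ => (unimodalCount m n : ℝ) ^ 2 -
          (unimodalCount (m - 1) n : ℝ) * (unimodalCount (m + 1) n : ℝ))
        (fun n : ℕ => Real.pi / (768 * √6 * (n : ℝ) ^ (5 / 2 : ℝ)) *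
          Real.exp (2 * Real.pi * √(2 * (n : ℝ) / 3)))) ∧
    (∀ m : ℤ, ∃ N : ℕ, ∀ n : ℕ, N ≤ n →
      unimodalCount (m - 1) n * unimodalCount (m + 1) n < unimodalCount m n ^ 2) := by
  have hequiv : ∀ {f g v : ℕ → ℝ} {c : ℝ}, c ≠ 0 → (∀ n ≠ 0, g n ≠ 0) →
      Filter.Tendsto (fun n ↦ f n / g n) Filter.atTop (nhds c) → (∀ n ≠ 0, v n = c * g n) →
      Asymptotics.IsEquivalent Filter.atTop f v := by
    intro f g v c hc hg h hv
    refine Asymptotics.isEquivalent_of_tendsto_one ?_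
    have h1 := h.const_mul c⁻¹
    rw [inv_mul_cancel₀ hc] at h1
    refine h1.congr' ?_
    filter_upwards [Filter.eventually_ne_atTop 0] with n hn
    have := hg n hn
    rw [Pi.div_apply, hv n hn]
    field_simp
  have hsq : ∀ n : ℕ, √(6 * (n : ℝ)) = √2 * √3 * √n := fun n ↦ by
    rw [← Real.sqrt_mul (by norm_num), ← Real.sqrt_mul (by norm_num)]; norm_num
  have h2 : √2 * √2 = 2 := Real.mul_self_sqrt (by norm_num)
  have h3 : √3 * √3 = 3 := Real.mul_self_sqrt (by norm_num)
  have h6 : √6 = √2 * √3 := by rw [← Real.sqrt_mul (by norm_num)]; norm_num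
  have p2 : √2 ≠ 0 := by positivity
  have p3 : √3 ≠ 0 := by positivity
  refine ⟨fun m ↦ ⟨?_, ?_, ?_⟩, fun m ↦ ?_⟩
  · refine hequiv (by norm_num) (fun n hn ↦ (UnimodalData.partitionScale_pos hn).ne')
      (UnimodalData.tendsto_unimodalCount_nat m) fun n hn ↦ ?_
    rw [UnimodalData.partitionScale]
    ring
  · refine hequiv (by positivity)
      (fun n hn ↦ (mul_pos (UnimodalData.partitionScale_pos hn) (saddle_pos hn)).ne')
      (UnimodalData.tendsto_unimodalCount_sub_nat m) fun n hn ↦ ?_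
    have hn' : (0 : ℝ) < n := by positivity
    have e : (n : ℝ) ^ (3 / 2 : ℝ) = n * √n := by
      rw [Real.sqrt_eq_rpow, ← Real.rpow_one_add' hn'.le (by norm_num)]; norm_num
    have ps : √(n : ℝ) ≠ 0 := by positivity
    rw [UnimodalData.partitionScale, saddle, e, hsq]
    field_simp
    rw [sq, h3]; norm_num
  · refine hequiv (by norm_num)
      (fun n hn ↦ (mul_pos (pow_pos (UnimodalData.partitionScale_pos hn) 2) (saddle_pos hn)).ne')
      (UnimodalData.tendsto_logConcavity m) fun n hn ↦ ?_
    have hn' : (0 : ℝ) < n := by positivity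
    have e : (n : ℝ) ^ (5 / 2 : ℝ) = n ^ 2 * √n := by
      rw [Real.sqrt_eq_rpow, ← Real.rpow_natCast, ← Real.rpow_add hn']; norm_num
    have ps : √(n : ℝ) ≠ 0 := by positivity
    rw [UnimodalData.partitionScale, saddle, e, hsq, h6, mul_assoc 2, two_mul, Real.exp_add]
    field_simp
    rw [sq √3, h3]; norm_num
  · have h := (UnimodalData.tendsto_logConcavity m).eventually
      (lt_mem_nhds (show (0 : ℝ) < 1 / 16 by norm_num))
    obtain ⟨N, hN⟩ := Filter.eventually_atTop.mp (h.and (Filter.eventually_ne_atTop 0))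
    refine ⟨N, fun n hn ↦ ?_⟩
    obtain ⟨hpos, hn0⟩ := hN n hn
    have hd := mul_pos (pow_pos (UnimodalData.partitionScale_pos hn0) 2) (saddle_pos hn0)
    rw [lt_div_iff₀ hd, zero_mul, sub_pos] at hpos
    exact_mod_cast hpos
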